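/- Setting. For a real function $t$ write $t^*(\omega)=\int_{\mathbb R} e^{i\omega x}t(x)\,dx$. Let $Y_1,\dots,Y_n$ be i.i.d. copies of $Y=\theta+\xi$, where $\theta$ and $\xi$ are independent with probability densities $f$ (unknown) and $g$ (known). Let $q=f*g$ be the density of $Y$. Fix an integer $m\ge 0$ and real weights $\psi_1,\psi_2$, and consider $$\Phi=\int_0^\infty \psi_1(\omega)\,\frac{d^m}{d\omega^m}\mathrm{Re}\,f^*(\omega)\,d\omega+\int_0^\infty \psi_2(\omega)\,\frac{d^m}{d\omega^m}\mathrm{Im}\,f^*(\omega)\,d\omega ,$$ where both integrals are assumed to converge absolutely. Estimator. Put $\hat v_{j1}(\omega)=n^{-1}\sum_l Y_l^j\cos(\omega Y_l)$ and $\hat v_{j2}(\omega)=n^{-1}\sum_l Y_l^j\sin(\omega Y_l)$. For even $j$ let $\hat u_{j1}=(-1)^{j/2}\hat v_{j1}$ and $\hat u_{j2}=(-1)^{j/2}\hat v_{j2}$. For odd $j$ let $\hat u_{j1}=(-1)^{(j+1)/2}\hat v_{j2}$ and $\hat u_{j2}=(-1)^{(j-1)/2}\hat v_{j1}$. These are unbiased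 estimators of $\mathrm{Re}\,(q^*)^{(j)}$ and $\mathrm{Im}\,(q^*)^{(j)}$. With $r(\omega)=1/g^*(\omega)$ and $0<h\le 1$, let $\hat\Phi_h=\hat\Phi_1+\hat F_m+\hat\Phi_{20,h}$, where $$\hat\Phi_1=\sum_{j=0}^m\binom mj\int_0^1 r^{(m-j)}\,[\psi_1\hat u_{j1}+\psi_2\hat u_{j2}]\,d\omega,$$ $$\hat F_m=\sum_{k=1}^m\sum_{j=0}^{m-k}(-1)^k\binom{m-k}{j}\Big[\psi_1^{(k-1)}r^{(m-k-j)}\hat u_{j1}+\psi_2^{(k-1)}r^{(m-k-j)}\hat u_{j2}\Big]_{\omega=1},$$ $$\hat\Phi_{20,h}=(-1)^m\int_1^{1/h}\big[\psi_1^{(m)}\hat u_{01}+\psi_2^{(m)}\hat u_{02}\big]\,r\,d\omega .$$ Let $\sigma_{jk}^2(\omega)=n\,\mathrm{Var}(\hat u_{jk}(\omega))$; this does not depend on $n$. Assumptions. (i) $\int x^{2m}g(x)\,dx<\infty$, $\int x^{2m}f(x)\,dx<\infty$, and $g$ is bounded. (ii) $g^*$ is real-valued, and there are constants $C_{g1}>0$,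 $C_{g2}$ and $\alpha,\beta,\gamma\ge0$, with $\alpha>0$ and $\beta=0$ if $\gamma=0$, such that $C_{g1}(\omega^2+1)^{-\alpha/2}e^{-\gamma|\omega|^\beta}\le|g^*(\omega)|\le C_{g2}(\omega^2+1)^{-\alpha/2}e^{-\gamma|\omega|^\beta}$ for all $\omega\in\mathbb R$. (iii) For some $C_g$ and some $\tau\ge0$, with $\tau=0$ if $\gamma=0$, $|(g^*)^{(j)}(\omega)/g^*(\omega)|\le C_g(|\omega|+1)^{j\tau}$ for $j=0,\dots,m$ and all $\omega\in\mathbb R$. (iv) $\psi_1,\psi_2$ are measurable and $m$ times differentiable on $[1,\infty)$ (one-sided at $1$). For some $C_\psi$ and $a_m,b,d\ge0$, with $b=0$ if $d=0$, $|\psi_k^{(j)}(\omega)|\le C_\psi(\omega^2+1)^{-a_m(j+1)/2}e^{-d\omega^b}$ for $\omega\ge1$, $j=0,\dots,m$, $k=1,2$. (v) For a constant $C_\sigma$, $\int_0^1 [r^{(m-j)}(\omega)]^2\,|\psi_k(\omega)|^2\,\sigma_{jk}^2(\omega)\,d\omega\le C_\sigma$ for $j=0,\dots,m$, $k=1,2$.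 Let $s\ge0$ and $B\in\mathbb R$. Suppose that either $f\in\Xi_s(B)=\{f:\sup_\omega|f^*(\omega)|(|\omega|^s+1)\le B\}$, in which case set $A=(m+1)a_m+s+b-1$, or $f\in\Omega_s(B)=\{f:\int|f^*(\omega)|^2(\omega^2+1)^s\,d\omega\le B^2\}$, in which case set $A=(m+1)a_m+s+(b-1)/2$. Conclusion. The integrals in $\hat\Phi_h$ converge absolutely, and there is a constant $C>0$ independent of $n$ and $h$ such that, for all $n\ge1$ and $0<h\le1$, $$\mathbb E(\hat\Phi_h-\Phi)^2\le C\Big[h^{2A}e^{-2dh^{-b}}+n^{-1}\int_1^{1/h}(\omega^2+1)^{\alpha-(m+1)a_m}e^{-2d\omega^b+2\gamma\omega^\beta}\,d\omega\Big].$$ Moreover, if $b>0$ or $A>0$, then for every $M$ the constant $C$ can be chosen the same for all $f$ in the class (for fixed $g,\psi_1,\psi_2$ and fixed constants $C_\sigma,s,B$) that satisfy the assumptions and $\int x^{2m}f(x)\,dx\le M$. -/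

import Mathlib

open MeasureTheory ProbabilityTheory Set

universe u

noncomputable section

namespace InvDeconv

/-- Fourier transform `t*(ω) = ∫ exp(i ω x) t(x) dx` of a real function. -/
def fourier (t : ℝ → ℝ) (ω : ℝ) : ℂ :=
  ∫ x : ℝ, Complex.exp (Complex.I * (ω : ℂ) * (x : ℂ)) * (t x : ℂ)

/-- `t` is a probability density on `ℝ`. -/
structure IsPdf (t : ℝ → ℝ) : Prop where
  measurable : Measurable t
  nonneg : ∀ x, 0 ≤ t x
  lintegral_eq_one : ∫⁻ x, ENNReal.ofReal (t x) = 1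

/-- The law on `ℝ` with density `t`. -/
def law (t : ℝ → ℝ) : Measure ℝ := volume.withDensity (fun x => ENNReal.ofReal (t x))

/-- The law of one observation `Y = θ + ξ`, where `θ` (density `f`) and `ξ` (density `g`) are
independent. -/
def obsLaw (f g : ℝ → ℝ) : Measure ℝ := Measure.conv (law f) (law g)

/-- `Y₁, …, Yₙ` are independent observations from the deconvolution model. -/
structure IsSample (f g : ℝ → ℝ) {n : ℕ} {Ω : Type u} [MeasurableSpace Ω] (P : Measure Ω)
    (Y : Fin n → Ω → ℝ) : Prop where
  measurable : ∀ i, Measurable (Y i)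
  indep : iIndepFun Y P
  law_eq : ∀ i, P.map (Y i) = obsLaw f g

/-- The moment of order `k` of `t` is finite (used for even `k`). -/
def HasMoment (k : ℕ) (t : ℝ → ℝ) : Prop := Integrable (fun x : ℝ => x ^ k * t x)

/-- The moment `∫ x^k t(x) dx`. -/
def moment (k : ℕ) (t : ℝ → ℝ) : ℝ := ∫ x : ℝ, x ^ k * t x

/-- The Sobolev ball `Ω_s(B)`. -/
def SobolevBall (s B : ℝ) : Set (ℝ → ℝ) :=
  {t | ∫⁻ ω : ℝ, ENNReal.ofReal (‖fourier t ω‖ ^ 2 * (ω ^ 2 + 1) ^ s) ≤ ENNReal.ofReal (B ^ 2)}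

/-- The class `Ξ_s(B)`. -/
def DecayBall (s B : ℝ) : Set (ℝ → ℝ) :=
  {t | ∀ ω : ℝ, ‖fourier t ω‖ * (|ω| ^ s + 1) ≤ B}

/-- The two-sided bounds on `|g*|`. -/
structure AssumptionA1 (g : ℝ → ℝ) (α β γ C₁ C₂ : ℝ) : Prop where
  α_nonneg : 0 ≤ α
  β_nonneg : 0 ≤ β
  γ_nonneg : 0 ≤ γ
  C₁_pos : 0 < C₁
  of_γ_eq_zero : γ = 0 → 0 < α ∧ β = 0
  lower : ∀ ω : ℝ, C₁ * (ω ^ 2 + 1) ^ (-α / 2) * Real.exp (-γ * |ω| ^ β) ≤ ‖fourier g ω‖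
  upper : ∀ ω : ℝ, ‖fourier g ω‖ ≤ C₂ * (ω ^ 2 + 1) ^ (-α / 2) * Real.exp (-γ * |ω| ^ β)

/-- The derivatives `(d/dω)^k (1 / g*(ω))`, for real-valued `g*`. -/
def invDeriv (g : ℝ → ℝ) (k : ℕ) (ω : ℝ) : ℝ :=
  iteratedDeriv k (fun w : ℝ => 1 / (fourier g w).re) ω

/-- The derivatives of a weight on `[1, ∞)`, one-sided at `1`. -/
def wDeriv (k : ℕ) (ψ : ℝ → ℝ) (ω : ℝ) : ℝ := iteratedDerivWithin k ψ (Ici 1) ω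

/-- `ψ` is measurable and, on `[1, ∞)`, it is `m` times differentiable with
`|ψ^(j)(ω)| ≤ C (ω² + 1)^(-a (j+1)/2) exp(-d ω^b)` for `j ≤ m`. -/
structure IsWeight (m : ℕ) (a b d C : ℝ) (ψ : ℝ → ℝ) : Prop where
  measurable : Measurable ψ
  differentiable : ∀ j < m, DifferentiableOn ℝ (wDeriv j ψ) (Ici 1)
  bound : ∀ j ≤ m, ∀ ω : ℝ, 1 ≤ ω →
    |wDeriv j ψ ω| ≤ C * (ω ^ 2 + 1) ^ (-(a * ((j : ℝ) + 1)) / 2) * Real.exp (-d * ω ^ b)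

/-- The functional
`Φ = ∫₀^∞ ψ₁ (d/dω)^m Re f* dω + ∫₀^∞ ψ₂ (d/dω)^m Im f* dω`. -/
def Phi (m : ℕ) (ψ₁ ψ₂ f : ℝ → ℝ) : ℝ :=
  (∫ ω in Ioi (0 : ℝ), ψ₁ ω * iteratedDeriv m (fun w => (fourier f w).re) ω) +
    ∫ ω in Ioi (0 : ℝ), ψ₂ ω * iteratedDeriv m (fun w => (fourier f w).im) ω

/-- The contribution of a single observation `y` to the estimator of `Re (d/dω)^j q*`. -/
def uRe (j : ℕ) (ω y : ℝ) : ℝ :=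
  if Even j then (-1) ^ (j / 2) * (y ^ j * Real.cos (ω * y))
  else (-1) ^ ((j + 1) / 2) * (y ^ j * Real.sin (ω * y))

/-- The contribution of a single observation `y` to the estimator of `Im (d/dω)^j q*`. -/
def uIm (j : ℕ) (ω y : ℝ) : ℝ :=
  if Even j then (-1) ^ (j / 2) * (y ^ j * Real.sin (ω * y))
  else (-1) ^ ((j - 1) / 2) * (y ^ j * Real.cos (ω * y))

/-- The estimator of `Re (d/dω)^j q*(ω)` from the sample `y`. -/
def uHatRe {n : ℕ} (y : Fin n → ℝ) (j : ℕ) (ω : ℝ) : ℝ := (n : ℝ)⁻¹ * ∑ l, uRe j ω (y l)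

/-- The estimator of `Im (d/dω)^j q*(ω)` from the sample `y`. -/
def uHatIm {n : ℕ} (y : Fin n → ℝ) (j : ℕ) (ω : ℝ) : ℝ := (n : ℝ)⁻¹ * ∑ l, uIm j ω (y l)

/-- `n` times the variance of the estimator of `Re (d/dω)^j q*(ω)`; as the sample is independent
and identically distributed, this is the variance of the contribution of one observation. -/
def sigmaSqRe (f g : ℝ → ℝ) (j : ℕ) (ω : ℝ) : ℝ := variance (uRe j ω) (obsLaw f g)

/-- `n` times the variance of the estimator of `Im (d/dω)^j q*(ω)`. -/
def sigmaSqIm (f g : ℝ → ℝ) (j : ℕ) (ω : ℝ) : ℝ := variance (uIm j ω) (obsLaw f g)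

/-- The integrand of the `j`-th term of the estimator of the part of `Φ` over `[0, 1]`. -/
def integrand1 (m : ℕ) (g ψ₁ ψ₂ : ℝ → ℝ) {n : ℕ} (y : Fin n → ℝ) (j : ℕ) (ω : ℝ) : ℝ :=
  invDeriv g (m - j) ω * (ψ₁ ω * uHatRe y j ω + ψ₂ ω * uHatIm y j ω)

/-- The estimator of the part of `Φ` over `[0, 1]`. -/
def PhiHat1 (m : ℕ) (g ψ₁ ψ₂ : ℝ → ℝ) {n : ℕ} (y : Fin n → ℝ) : ℝ :=
  ∑ j ∈ Finset.range (m + 1),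
    (m.choose j : ℝ) * ∫ ω in (0 : ℝ)..1, integrand1 m g ψ₁ ψ₂ y j ω

/-- `A_{m,j,k}(ω) = ψ^(k-1)(ω) (d/dω)^(m-k-j) (1 / g*(ω))`. -/
def coefA (m j k : ℕ) (g ψ : ℝ → ℝ) (ω : ℝ) : ℝ := wDeriv (k - 1) ψ ω * invDeriv g (m - k - j) ω

/-- The estimator of the boundary term at `ω = 1`. -/
def FHat (m : ℕ) (g ψ₁ ψ₂ : ℝ → ℝ) {n : ℕ} (y : Fin n → ℝ) : ℝ :=
  ∑ k ∈ Finset.Icc 1 m, ∑ j ∈ Finset.range (m - k + 1),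
    (-1) ^ k * ((m - k).choose j : ℝ) *
      (coefA m j k g ψ₁ 1 * uHatRe y j 1 + coefA m j k g ψ₂ 1 * uHatIm y j 1)

/-- The integrand of the estimator of the remaining integral over `(1, ∞)`. -/
def integrand2 (m : ℕ) (g ψ₁ ψ₂ : ℝ → ℝ) {n : ℕ} (y : Fin n → ℝ) (ω : ℝ) : ℝ :=
  (wDeriv m ψ₁ ω * uHatRe y 0 ω + wDeriv m ψ₂ ω * uHatIm y 0 ω) * (1 / (fourier g ω).re)

/-- The truncated estimator of the remaining integral over `(1, ∞)`. -/
def PhiHat20 (m : ℕ) (g ψ₁ ψ₂ : ℝ → ℝ) (h : ℝ) {n : ℕ} (y : Fin n → ℝ) : ℝ :=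
  (-1) ^ m * ∫ ω in (1 : ℝ)..(1 / h), integrand2 m g ψ₁ ψ₂ y ω

/-- The estimator `Φ̂_h` of `Φ`. -/
def PhiHat (m : ℕ) (g ψ₁ ψ₂ : ℝ → ℝ) (h : ℝ) {n : ℕ} (y : Fin n → ℝ) : ℝ :=
  PhiHat1 m g ψ₁ ψ₂ y + FHat m g ψ₁ ψ₂ y + PhiHat20 m g ψ₁ ψ₂ h y

/-- The conditions on the mixing density `f`: finite moment of order `2m`, absolute convergence of
the two integrals in `Φ`, and the variance conditions on `[0, 1]` with constant `Cσ`. -/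
structure Admissible (m : ℕ) (g ψ₁ ψ₂ : ℝ → ℝ) (Cσ : ℝ) (f : ℝ → ℝ) : Prop where
  pdf : IsPdf f
  hasMoment : HasMoment (2 * m) f
  integrable_re : IntegrableOn
    (fun ω => ψ₁ ω * iteratedDeriv m (fun w => (fourier f w).re) ω) (Ioi 0)
  integrable_im : IntegrableOn
    (fun ω => ψ₂ ω * iteratedDeriv m (fun w => (fourier f w).im) ω) (Ioi 0)
  variance_re : ∀ j ≤ m, ∫⁻ ω in Icc (0 : ℝ) 1, ENNReal.ofReal
    ((invDeriv g (m - j) ω) ^ 2 * |ψ₁ ω| ^ 2 * sigmaSqRe f g j ω) ≤ ENNReal.ofReal Cσ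
  variance_im : ∀ j ≤ m, ∫⁻ ω in Icc (0 : ℝ) 1, ENNReal.ofReal
    ((invDeriv g (m - j) ω) ^ 2 * |ψ₂ ω| ^ 2 * sigmaSqIm f g j ω) ≤ ENNReal.ofReal Cσ

/-- The rate
`h^(2A) exp(-2 d h^(-b)) + n⁻¹ ∫₁^{1/h} (ω²+1)^(α-(m+1)a) exp(-2 d ω^b + 2 γ ω^β) dω`. -/
def rate (m : ℕ) (α β γ a b d A : ℝ) (n : ℕ) (h : ℝ) : ℝ :=
  h ^ (2 * A) * Real.exp (-2 * d * h ^ (-b)) +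
    (n : ℝ)⁻¹ * ∫ ω in (1 : ℝ)..(1 / h),
      (ω ^ 2 + 1) ^ (α - ((m : ℝ) + 1) * a) * Real.exp (-2 * d * ω ^ b + 2 * γ * ω ^ β)

/-- For every sample size `n ≥ 1` and every `0 < h ≤ 1`, the integrals in the estimator converge
absolutely and its mean squared error is at most `R n h`. -/
def RiskBound (m : ℕ) (g ψ₁ ψ₂ f : ℝ → ℝ) (R : ℕ → ℝ → ℝ) : Prop :=
  ∀ (n : ℕ), 1 ≤ n → ∀ (h : ℝ), 0 < h → h ≤ 1 →
    (∀ y : Fin n → ℝ,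
      (∀ j ≤ m, IntervalIntegrable (integrand1 m g ψ₁ ψ₂ y j) volume 0 1) ∧
        IntervalIntegrable (integrand2 m g ψ₁ ψ₂ y) volume 1 (1 / h)) ∧
    ∀ (Ω : Type u) [MeasurableSpace Ω] (P : Measure Ω) [IsProbabilityMeasure P]
      (Y : Fin n → Ω → ℝ), IsSample f g P Y →
      ∫⁻ x, ENNReal.ofReal ((PhiHat m g ψ₁ ψ₂ h (fun i => Y i x) - Phi m ψ₁ ψ₂ f) ^ 2) ∂P ≤
        ENNReal.ofReal (R n h)

end InvDeconv

end

open InvDeconv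

/-!
Leibniz' rule for `f* = q* · (1 / g*)` on `[0, 1]` and `m` integrations by parts on `[1, H]` show
that the estimator with bandwidth `h = 1 / H` is the empirical mean of a function of one observation
whose expectation tends to `Φ` as `H → ∞`. Its mean squared error is therefore its squared bias plus
`1 / n` times the variance of that function.

The bias is a limit of integrals of `ψ⁽ᵐ⁾ f*` over `[H, T]`; it is estimated by the decay of `ψ⁽ᵐ⁾`
together with the decay of `f*` or, in the Sobolev case, the Cauchy–Schwarz inequality. The variance
of the `[0, 1]` part is bounded by Minkowski's inequality and the assumption on `σ²`, that of the
boundary term by moments. Since the density of an observation is bounded, Plancherel's theorem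
bounds the variance of the `[1, H]` part by the integral of `(ψ⁽ᵐ⁾ / g*)²` rather than by the square
of an `L¹` norm. Terms of order `1 / n` are absorbed by the rate, which is at least a constant times
`1 / n`.

The integrals over `[0, 1]` converge because the law of an observation has a density: the variance
of `yʲ cos(ωy)` is bounded below by a positive constant and that of `yʲ sin(ωy)` by a positive
multiple of `ω²`, so that the assumption on `σ²` gives the square integrability of their
coefficients. Only `cos(ωy)` itself degenerates as `ω → 0`; its coefficient is integrable because
`Φ` converges.
-/

namespace InvDeconv

section Model

theorem isProbabilityMeasure_law {t : ℝ → ℝ} (ht : IsPdf t) : IsProbabilityMeasure (law t) :=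
  ⟨by rw [law, withDensity_apply _ MeasurableSet.univ, Measure.restrict_univ, ht.lintegral_eq_one]⟩

theorem integral_law {E : Type*} [NormedAddCommGroup E] [NormedSpace ℝ E]
    {t : ℝ → ℝ} (ht : IsPdf t) (φ : ℝ → E) : ∫ x, φ x ∂(law t) = ∫ x, t x • φ x := by
  rw [law, integral_withDensity_eq_integral_toReal_smul ht.measurable.ennreal_ofReal
    (by simp)]
  simp_rw [ENNReal.toReal_ofReal (ht.nonneg _)]

theorem integrable_law_iff {t : ℝ → ℝ} (ht : IsPdf t) (φ : ℝ → ℝ) :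
    Integrable φ (law t) ↔ Integrable (fun x => φ x * t x) := by
  rw [law, integrable_withDensity_iff ht.measurable.ennreal_ofReal (by simp)]
  simp_rw [ENNReal.toReal_ofReal (ht.nonneg _)]

theorem fourier_eq_charFun {t : ℝ → ℝ} (ht : IsPdf t) : fourier t = charFun (law t) := by
  ext ω
  rw [charFun_apply_real, integral_law ht, fourier]
  refine integral_congr_ae (.of_forall fun x => ?_)
  simp only [Complex.real_smul]
  rw [mul_comm]
  congr 2
  ring

theorem memLp_id_of_integrable_pow {k : ℕ} (hk : Even k) {μ : Measure ℝ} [IsFiniteMeasure μ]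
    (h : Integrable (fun x => x ^ k) μ) : MemLp id k μ := by
  rcases Nat.eq_zero_or_pos k with rfl | hk0
  · simpa using by fun_prop
  · rw [← integrable_norm_rpow_iff (by fun_prop) (by simpa using hk0.ne') (by simp)]
    refine h.congr (.of_forall fun x => ?_)
    simp [hk.pow_abs]

theorem memLp_id_law {m : ℕ} {t : ℝ → ℝ} (ht : IsPdf t) (hm : HasMoment (2 * m) t) :
    MemLp id (2 * m : ℕ) (law t) := by
  have := isProbabilityMeasure_law ht
  exact memLp_id_of_integrable_pow (even_two_mul m) ((integrable_law_iff ht _).2 hm)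

theorem integral_pow_law {t : ℝ → ℝ} (ht : IsPdf t) (k : ℕ) :
    ∫ x, x ^ k ∂(law t) = moment k t := by
  rw [integral_law ht, moment]
  simp_rw [smul_eq_mul, mul_comm]

theorem integrable_pow_of_memLp {n j : ℕ} {μ : Measure ℝ} [IsFiniteMeasure μ]
    (h : MemLp id n μ) (hj : j ≤ n) : Integrable (fun x => x ^ j) μ := by
  have h' : MemLp id j μ := h.mono_exponent (by simpa using hj)
  refine h'.integrable_norm_pow'.mono (by fun_prop) (.of_forall fun x => by simp)

theorem integrable_abs_pow_of_memLp {n j : ℕ} {μ : Measure ℝ} [IsFiniteMeasure μ]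
    (h : MemLp id n μ) (hj : j ≤ n) : Integrable (fun x => |x| ^ j) μ := by
  simpa [abs_pow] using (integrable_pow_of_memLp h hj).abs

variable {f g : ℝ → ℝ}

theorem isProbabilityMeasure_obsLaw (hf : IsPdf f) (hg : IsPdf g) :
    IsProbabilityMeasure (obsLaw f g) := by
  have := isProbabilityMeasure_law hf
  have := isProbabilityMeasure_law hg
  unfold obsLaw
  infer_instance

theorem charFun_obsLaw (hf : IsPdf f) (hg : IsPdf g) (ω : ℝ) :
    charFun (obsLaw f g) ω = fourier f ω * fourier g ω := by
  have := isProbabilityMeasure_law hf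
  have := isProbabilityMeasure_law hg
  rw [obsLaw, charFun_conv, fourier_eq_charFun hf, fourier_eq_charFun hg]

theorem memLp_id_obsLaw (hf : IsPdf f) (hg : IsPdf g) {m : ℕ} (hfm : HasMoment (2 * m) f)
    (hgm : HasMoment (2 * m) g) : MemLp id (2 * m : ℕ) (obsLaw f g) := by
  have := isProbabilityMeasure_law hf
  have := isProbabilityMeasure_law hg
  rw [obsLaw, Measure.conv, memLp_map_measure_iff (by fun_prop) (by fun_prop)]
  have h1 := (memLp_id_law hf hfm).comp_measurePreserving
    (measurePreserving_fst (μ := law f) (ν := law g))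
  have h2 := (memLp_id_law hg hgm).comp_measurePreserving
    (measurePreserving_snd (μ := law f) (ν := law g))
  exact h1.add h2

theorem integral_pow_obsLaw_le (hf : IsPdf f) (hg : IsPdf g) {m : ℕ}
    (hfm : HasMoment (2 * m) f) (hgm : HasMoment (2 * m) g) :
    ∫ y, y ^ (2 * m) ∂(obsLaw f g) ≤
      2 ^ (2 * m - 1) * (moment (2 * m) f + moment (2 * m) g) := by
  have := isProbabilityMeasure_law hf
  have := isProbabilityMeasure_law hg
  have := isProbabilityMeasure_obsLaw hf hg
  have hq := integrable_pow_of_memLp (memLp_id_obsLaw hf hg hfm hgm) le_rfl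
  have hi := hq
  rw [obsLaw, Measure.conv, integrable_map_measure (by fun_prop) (by fun_prop)] at hi
  have h1 := (integrable_pow_of_memLp (memLp_id_law hf hfm) le_rfl).comp_fst (law g)
  have h2 := (integrable_pow_of_memLp (memLp_id_law hg hgm) le_rfl).comp_snd (law f)
  rw [obsLaw, Measure.conv, integral_map (by fun_prop) (by fun_prop)]
  calc ∫ p : ℝ × ℝ, (p.1 + p.2) ^ (2 * m) ∂((law f).prod (law g))
      ≤ ∫ p : ℝ × ℝ, 2 ^ (2 * m - 1) * (p.1 ^ (2 * m) + p.2 ^ (2 * m)) ∂((law f).prod (law g)) :=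
        integral_mono hi ((h1.add h2).const_mul _) fun p => (even_two_mul m).add_pow_le
    _ = _ := by
        rw [integral_const_mul, integral_add h1 h2,
          integral_fun_fst (f := fun x : ℝ => x ^ (2 * m)),
          integral_fun_snd (f := fun x : ℝ => x ^ (2 * m)), integral_pow_law hf,
          integral_pow_law hg]
        simp

theorem obsLaw_le (hf : IsPdf f) (hg : IsPdf g) {K : ℝ} (hK : ∀ᵐ x ∂volume, g x ≤ K) :
    obsLaw f g ≤ ENNReal.ofReal K • (volume : Measure ℝ) := by
  have := isProbabilityMeasure_law hf
  have := isProbabilityMeasure_law hg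
  have hlaw : law g ≤ ENNReal.ofReal K • (volume : Measure ℝ) := by
    rw [law, ← withDensity_const]
    exact withDensity_mono (hK.mono fun x hx => ENNReal.ofReal_le_ofReal hx)
  refine Measure.le_iff.2 fun S hS => ?_
  rw [← lintegral_indicator_one hS, obsLaw,
    Measure.lintegral_conv (measurable_one.indicator hS)]
  calc ∫⁻ x, ∫⁻ y, S.indicator 1 (x + y) ∂(law g) ∂(law f)
      ≤ ∫⁻ _, ENNReal.ofReal K * volume S ∂(law f) := by
        refine lintegral_mono fun x => ?_
        calc ∫⁻ y, S.indicator 1 (x + y) ∂(law g)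
            ≤ ∫⁻ y, S.indicator 1 (x + y) ∂(ENNReal.ofReal K • (volume : Measure ℝ)) :=
              lintegral_mono' hlaw le_rfl
          _ = _ := by
              rw [lintegral_smul_measure, lintegral_add_left_eq_self
                (f := S.indicator (1 : ℝ → ENNReal)), lintegral_indicator_one hS, smul_eq_mul]
    _ = _ := by simp

theorem obsLaw_absolutelyContinuous (hf : IsPdf f) (hg : IsPdf g) {K : ℝ}
    (hK : ∀ᵐ x ∂volume, g x ≤ K) : obsLaw f g ≪ volume :=
  (Measure.absolutelyContinuous_of_le (obsLaw_le hf hg hK)).trans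
    (Measure.smul_absolutelyContinuous)

end Model

section TrigDeriv

open Complex (I)

/-- The `j`-th derivative in `ω` of `ℓ (exp (i ω y))`, for a real-linear functional `ℓ` on `ℂ`.
Taking `ℓ = Re` and `ℓ = Im` gives `uRe` and `uIm`, so both parts of the estimator are treated at
once. -/
noncomputable def trigDeriv (ℓ : ℂ →L[ℝ] ℝ) (j : ℕ) (ω y : ℝ) : ℝ :=
  ℓ ((I * y) ^ j * Complex.exp (ω * y * I))

theorem I_mul_pow_mul_exp_eq_uRe_add_uIm_mul_I (j : ℕ) (ω y : ℝ) :
    (I * y) ^ j * Complex.exp (ω * y * I) = (uRe j ω y : ℂ) + (uIm j ω y : ℂ) * I := by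
  rw [Complex.exp_mul_I, mul_pow]
  rcases Nat.even_or_odd' j with ⟨k, rfl | rfl⟩
  · simp only [uRe, uIm, even_two_mul k, if_true, pow_mul, Complex.I_sq,
      Nat.mul_div_cancel_left k two_pos]
    push_cast
    ring
  · have hodd : ¬ Even (2 * k + 1) := by simp
    have hup : (2 * k + 1 + 1) / 2 = k + 1 := by omega
    have hdown : (2 * k + 1 - 1) / 2 = k := by omega
    simp only [uRe, uIm, hodd, if_false, hup, hdown]
    rw [pow_succ I, pow_mul I, Complex.I_sq]
    push_cast
    linear_combination ((-1 : ℂ) ^ k * (y : ℂ) ^ (2 * k + 1) * Complex.sin (ω * y)) * Complex.I_sq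

theorem trigDeriv_reCLM (j : ℕ) : trigDeriv Complex.reCLM j = uRe j := by
  ext ω y
  simp [trigDeriv, I_mul_pow_mul_exp_eq_uRe_add_uIm_mul_I]

theorem trigDeriv_imCLM (j : ℕ) : trigDeriv Complex.imCLM j = uIm j := by
  ext ω y
  simp [trigDeriv, I_mul_pow_mul_exp_eq_uRe_add_uIm_mul_I]

variable (ℓ : ℂ →L[ℝ] ℝ)

theorem trigDeriv_eq_cos_add_sin (j : ℕ) (ω y : ℝ) :
    trigDeriv ℓ j ω y =
      y ^ j * (Real.cos (ω * y) * ℓ (I ^ j) + Real.sin (ω * y) * ℓ (I ^ (j + 1))) := by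
  have hsplit : (I * y) ^ j * Complex.exp (ω * y * I) =
      (y ^ j * Real.cos (ω * y)) • I ^ j + (y ^ j * Real.sin (ω * y)) • I ^ (j + 1) := by
    rw [Complex.exp_mul_I]
    simp only [Complex.real_smul]
    push_cast
    ring
  rw [trigDeriv, hsplit, map_add, map_smul, map_smul]
  simp only [smul_eq_mul]
  ring

theorem abs_trigDeriv_le (j : ℕ) (ω y : ℝ) : |trigDeriv ℓ j ω y| ≤ ‖ℓ‖ * |y| ^ j := by
  refine (ℓ.le_opNorm _).trans_eq ?_
  rw [← Complex.ofReal_mul, norm_mul, Complex.norm_exp_ofReal_mul_I]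
  simp

theorem continuous_trigDeriv (j : ℕ) : Continuous fun p : ℝ × ℝ => trigDeriv ℓ j p.1 p.2 := by
  unfold trigDeriv
  fun_prop

theorem continuous_trigDeriv_right (j : ℕ) (ω : ℝ) : Continuous (trigDeriv ℓ j ω) := by
  unfold trigDeriv
  fun_prop

theorem continuous_trigDeriv_left (j : ℕ) (y : ℝ) : Continuous fun ω => trigDeriv ℓ j ω y := by
  unfold trigDeriv
  fun_prop

variable {μ : Measure ℝ} [IsFiniteMeasure μ] {n : ℕ}

theorem memLp_two_trigDeriv {m : ℕ} (h : MemLp id (2 * m : ℕ) μ) {j : ℕ} (hj : j ≤ m) (ω : ℝ) :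
    MemLp (trigDeriv ℓ j ω) 2 μ := by
  have hmeas := (continuous_trigDeriv_right ℓ j ω).aestronglyMeasurable (μ := μ)
  rw [memLp_two_iff_integrable_sq hmeas]
  refine ((integrable_abs_pow_of_memLp h (j := j * 2) (by omega)).const_mul (‖ℓ‖ ^ 2)).mono'
    (hmeas.pow 2) (.of_forall fun y => ?_)
  rw [Real.norm_eq_abs, abs_pow, pow_mul, ← mul_pow]
  exact pow_le_pow_left₀ (abs_nonneg _) (abs_trigDeriv_le ℓ j ω y) 2

theorem iteratedDeriv_clm_comp {E F : Type*} [NormedAddCommGroup E] [NormedSpace ℝ E]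
    [NormedAddCommGroup F] [NormedSpace ℝ F] (L : E →L[ℝ] F) {k : ℕ} {φ : ℝ → E} {ω : ℝ}
    (hφ : ContDiffAt ℝ k φ ω) :
    iteratedDeriv k (fun w => L (φ w)) ω = L (iteratedDeriv k φ ω) := by
  simp only [iteratedDeriv]
  exact congrArg (fun T => T fun _ => (1 : ℝ)) (L.iteratedFDeriv_comp_left hφ le_rfl)

theorem iteratedDeriv_clm_comp_charFun (h : MemLp id n μ) {j : ℕ} (hj : j ≤ n) (ω : ℝ) :
    iteratedDeriv j (fun w => ℓ (charFun μ w)) ω = ∫ y, trigDeriv ℓ j ω y ∂μ := by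
  have hLp : MemLp id j μ := h.mono_exponent (by simpa using hj)
  have hint : Integrable (fun y : ℝ => (I * y) ^ j * Complex.exp (ω * y * I)) μ := by
    refine (integrable_abs_pow_of_memLp h hj).mono' (by fun_prop) (.of_forall fun y => ?_)
    rw [← Complex.ofReal_mul, norm_mul, Complex.norm_exp_ofReal_mul_I]
    simp
  rw [iteratedDeriv_clm_comp ℓ (contDiff_charFun hLp).contDiffAt, iteratedDeriv_charFun hLp]
  simp_rw [trigDeriv]
  rw [ℓ.integral_comp_comm hint, ← integral_const_mul]
  simp only [mul_pow, mul_assoc]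

end TrigDeriv

section Plancherel

open FourierTransform

variable {V F : Type*} [NormedAddCommGroup V] [InnerProductSpace ℝ V] [FiniteDimensional ℝ V]
  [MeasurableSpace V] [BorelSpace V] [NormedAddCommGroup F] [InnerProductSpace ℂ F]
  [CompleteSpace F]

theorem coeFn_fourier_toLp_ae_eq {k : V → F} (hk : Integrable k) (hk2 : MemLp k 2) :
    (𝓕 hk2.toLp : Lp F 2 (volume : Measure V)) =ᵐ[volume] 𝓕 k := by
  refine ae_eq_of_integral_contDiff_smul_eq
    ((Lp.memLp (𝓕 hk2.toLp)).locallyIntegrable one_le_two)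
    (VectorFourier.fourierIntegral_continuous Real.continuous_fourierChar
      (L := innerₗ V) continuous_inner hk).locallyIntegrable fun φ hφ hφc => ?_
  have hsupp : HasCompactSupport (Complex.ofRealCLM ∘ φ) := hφc.comp_left rfl
  set Φ : SchwartzMap V ℂ := hsupp.toSchwartzMap (Complex.ofRealCLM.contDiff.comp hφ)
  calc ∫ x, φ x • (𝓕 hk2.toLp : Lp F 2 (volume : Measure V)) x
      = Lp.toTemperedDistribution (𝓕 hk2.toLp) Φ := by simp [Φ]
    _ = Lp.toTemperedDistribution hk2.toLp (𝓕 Φ) := by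
        rw [← Lp.fourier_toTemperedDistribution_eq, TemperedDistribution.fourier_apply]
    _ = ∫ x, (𝓕 Φ) x • k x := by
        rw [Lp.toTemperedDistribution_apply]
        exact integral_congr_ae (hk2.coeFn_toLp.mono fun x hx => congrArg _ hx)
    _ = ∫ x, Φ x • 𝓕 k x := by
        simpa using! VectorFourier.integral_fourierIntegral_smul_eq_flip (L := innerₗ V)
          Real.continuous_fourierChar continuous_inner Φ.integrable hk
    _ = ∫ x, φ x • 𝓕 k x := by simp [Φ]

theorem eLpNorm_fourier_eq {k : V → F} (hk : Integrable k) (hk2 : MemLp k 2) :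
    eLpNorm (𝓕 k) 2 volume = eLpNorm k 2 volume := by
  have hnorm := Lp.norm_fourier_eq hk2.toLp
  rw [Lp.norm_def, Lp.norm_toLp,
    ENNReal.toReal_eq_toReal_iff' (Lp.eLpNorm_ne_top _) hk2.eLpNorm_ne_top] at hnorm
  rw [← hnorm, eLpNorm_congr_ae (coeFn_fourier_toLp_ae_eq hk hk2)]

theorem lintegral_enorm_sq_integral_mul_exp {k : ℝ → ℂ} (hk : Integrable k) (hk2 : MemLp k 2) :
    ∫⁻ y : ℝ, ‖∫ ω : ℝ, k ω * Complex.exp (ω * y * Complex.I)‖ₑ ^ 2 =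
      ENNReal.ofReal (2 * Real.pi) * ∫⁻ ω, ‖k ω‖ₑ ^ 2 := by
  have hscale : -(2 * Real.pi)⁻¹ ≠ 0 := by simp [Real.pi_ne_zero]
  have hfourier : ∀ y : ℝ, ∫ ω : ℝ, k ω * Complex.exp (ω * y * Complex.I) =
      𝓕 k (y * -(2 * Real.pi)⁻¹) := fun y => by
    rw [Real.fourier_real_eq_integral_exp_smul]
    refine integral_congr_ae (.of_forall fun ω => ?_)
    simp only [smul_eq_mul]
    rw [mul_comm]
    congr 2
    push_cast
    field_simp
  have hplancherel : ∫⁻ ξ, ‖𝓕 k ξ‖ₑ ^ 2 = ∫⁻ ω, ‖k ω‖ₑ ^ 2 := by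
    have hLp := eLpNorm_fourier_eq hk hk2
    simp only [eLpNorm_eq_lintegral_rpow_enorm_toReal two_ne_zero ENNReal.ofNat_ne_top,
      ENNReal.toReal_ofNat, ENNReal.rpow_ofNat] at hLp
    exact ENNReal.rpow_left_injective (by norm_num) hLp
  simp_rw [hfourier]
  rw [← (measurableEmbedding_mulRight₀ hscale).lintegral_map (fun ξ => ‖𝓕 k ξ‖ₑ ^ 2),
    Real.map_volume_mul_right hscale, lintegral_smul_measure, hplancherel, smul_eq_mul,
    inv_neg, inv_inv, abs_neg, abs_of_pos Real.two_pi_pos]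

theorem setIntegral_mul_trigDeriv_zero (ℓ : ℂ →L[ℝ] ℝ) {S : Set ℝ} (hS : MeasurableSet S)
    {κ : ℝ → ℝ} (hκ : IntegrableOn κ S) (y : ℝ) :
    ∫ ω in S, κ ω * trigDeriv ℓ 0 ω y =
      ℓ (∫ ω : ℝ, S.indicator (fun ω => (κ ω : ℂ)) ω * Complex.exp (ω * y * Complex.I)) := by
  have hk : Integrable (S.indicator fun ω => (κ ω : ℂ)) := (integrable_indicator_iff hS).2 hκ.ofReal
  have hexp : Integrable fun ω : ℝ =>
      S.indicator (fun ω => (κ ω : ℂ)) ω * Complex.exp (ω * y * Complex.I) :=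
    hk.mul_bdd (c := 1) (by fun_prop)
      (.of_forall fun ω => by rw [← Complex.ofReal_mul, Complex.norm_exp_ofReal_mul_I])
  rw [← ℓ.integral_comp_comm hexp, ← integral_indicator hS]
  refine integral_congr_ae (.of_forall fun ω => ?_)
  by_cases hω : ω ∈ S <;> simp [hω, trigDeriv, ← Complex.real_smul]

theorem lintegral_sq_setIntegral_trigDeriv_zero_le (ℓ : ℂ →L[ℝ] ℝ) {μ : Measure ℝ} {K : ℝ}
    (hK : 0 ≤ K) (hμ : μ ≤ ENNReal.ofReal K • (volume : Measure ℝ)) {S : Set ℝ}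
    (hS : MeasurableSet S) {κ : ℝ → ℝ} (hκ : IntegrableOn κ S)
    (hκ2 : MemLp κ 2 (volume.restrict S)) :
    ∫⁻ y, ENNReal.ofReal ((∫ ω in S, κ ω * trigDeriv ℓ 0 ω y) ^ 2) ∂μ ≤
      ENNReal.ofReal (‖ℓ‖ ^ 2 * (K * (2 * Real.pi)) * ∫ ω in S, κ ω ^ 2) := by
  set k : ℝ → ℂ := S.indicator fun ω => (κ ω : ℂ)
  have hk : Integrable k := (integrable_indicator_iff hS).2 hκ.ofReal
  have hk2 : MemLp k 2 := (memLp_indicator_iff_restrict hS).2 hκ2.ofReal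
  have hnorm : ∫⁻ ω, ‖k ω‖ₑ ^ 2 = ENNReal.ofReal (∫ ω in S, κ ω ^ 2) := by
    rw [ofReal_integral_eq_lintegral_ofReal hκ2.integrable_sq (.of_forall fun ω => sq_nonneg _),
      ← lintegral_indicator hS]
    refine lintegral_congr fun ω => ?_
    by_cases hω : ω ∈ S <;>
      simp [k, hω, ← ofReal_norm, ← ENNReal.ofReal_pow]
  calc ∫⁻ y, ENNReal.ofReal ((∫ ω in S, κ ω * trigDeriv ℓ 0 ω y) ^ 2) ∂μ
      ≤ ∫⁻ y, ENNReal.ofReal (‖ℓ‖ ^ 2) *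
          ‖∫ ω, k ω * Complex.exp (ω * y * Complex.I)‖ₑ ^ 2 ∂μ := by
        refine lintegral_mono fun y => ?_
        rw [setIntegral_mul_trigDeriv_zero ℓ hS hκ, ← ofReal_norm,
          ← ENNReal.ofReal_pow (norm_nonneg _),
          ← ENNReal.ofReal_mul (sq_nonneg _), ← mul_pow, ← sq_abs]
        gcongr
        exact ℓ.le_opNorm _
    _ ≤ ∫⁻ y, ENNReal.ofReal (‖ℓ‖ ^ 2) *
          ‖∫ ω, k ω * Complex.exp (ω * y * Complex.I)‖ₑ ^ 2
            ∂(ENNReal.ofReal K • (volume : Measure ℝ)) := lintegral_mono' hμ le_rfl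
    _ = ENNReal.ofReal (‖ℓ‖ ^ 2 * (K * (2 * Real.pi)) * ∫ ω in S, κ ω ^ 2) := by
        rw [lintegral_smul_measure, lintegral_const_mul' _ _ ENNReal.ofReal_ne_top,
          lintegral_enorm_sq_integral_mul_exp hk hk2, hnorm, smul_eq_mul,
          ← ENNReal.ofReal_mul Real.two_pi_pos.le, ← ENNReal.ofReal_mul (sq_nonneg _),
          ← ENNReal.ofReal_mul hK]
        congr 1
        ring

end Plancherel

section Nondegenerate

open Filter Topology
open scoped ENNReal

theorem lowerSemicontinuous_lintegral {α β : Type*} [TopologicalSpace α]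
    [FirstCountableTopology α] [MeasurableSpace β] {μ : Measure β} {φ : α → β → ℝ≥0∞}
    (hmeas : ∀ a, Measurable (φ a)) (hcont : ∀ y, Continuous fun a => φ a y) :
    LowerSemicontinuous fun a => ∫⁻ y, φ a y ∂μ := fun a =>
  lowerSemicontinuousAt_iff_le_liminf.2 <|
    calc ∫⁻ y, φ a y ∂μ
        = ∫⁻ y, liminf (fun b => φ b y) (𝓝 a) ∂μ :=
          lintegral_congr fun y => ((hcont y).tendsto a).liminf_eq.symm
      _ ≤ liminf (fun b => ∫⁻ y, φ b y ∂μ) (𝓝 a) := lintegral_liminf_le hmeas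

section Family

variable {β : Type*} [MeasurableSpace β] {μ : Measure β} [IsProbabilityMeasure μ]

theorem lintegral_prod_sub_sq_le {X : β → ℝ} (hX : Measurable X) :
    ∫⁻ p, ENNReal.ofReal ((X p.1 - X p.2) ^ 2) ∂(μ.prod μ) ≤ 4 * evariance X μ := by
  set e := ∫ y, X y ∂μ
  set D : β → ℝ≥0∞ := fun y => ENNReal.ofReal ((X y - e) ^ 2)
  have hD : Measurable D := by fun_prop
  calc ∫⁻ p, ENNReal.ofReal ((X p.1 - X p.2) ^ 2) ∂(μ.prod μ)
      ≤ ∫⁻ p, 2 * (D p.1 + D p.2) ∂(μ.prod μ) := by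
        refine lintegral_mono fun p => ?_
        rw [← ENNReal.ofReal_add (sq_nonneg _) (sq_nonneg _),
          show (2 : ℝ≥0∞) = ENNReal.ofReal 2 by simp, ← ENNReal.ofReal_mul two_pos.le]
        refine ENNReal.ofReal_le_ofReal ?_
        nlinarith [sq_nonneg (X p.1 - e + (X p.2 - e))]
    _ = 2 * (∫⁻ y, D y ∂μ + ∫⁻ y, D y ∂μ) := by
        rw [lintegral_const_mul _ (by fun_prop), lintegral_add_left (by fun_prop),
          measurePreserving_fst.lintegral_comp hD, measurePreserving_snd.lintegral_comp hD]
    _ = 4 * evariance X μ := by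
        rw [evariance_eq_lintegral_ofReal, ← two_mul, ← mul_assoc]
        congr 1
        norm_num

theorem lintegral_prod_sub_sq_ne_zero {X : β → ℝ} (hX : Measurable X)
    (hne : ∀ c, ¬ X =ᵐ[μ] fun _ => c) :
    ∫⁻ p, ENNReal.ofReal ((X p.1 - X p.2) ^ 2) ∂(μ.prod μ) ≠ 0 := by
  intro h
  rw [lintegral_eq_zero_iff (by fun_prop)] at h
  obtain ⟨y, hy⟩ := (Measure.ae_ae_of_ae_prod h).exists
  refine hne (X y) ?_
  filter_upwards [hy] with z hz
  have hsq : (X y - X z) ^ 2 ≤ 0 := ENNReal.ofReal_eq_zero.1 hz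
  exact (sub_eq_zero.1 (pow_eq_zero_iff two_ne_zero |>.1 (hsq.antisymm (sq_nonneg _)))).symm

-- `evariance (φ a)` itself need not be lower semicontinuous in `a`, since the mean may jump; the
-- integral over pairs is.
theorem exists_pos_le_evariance {α : Type*} [TopologicalSpace α] [FirstCountableTopology α]
    {φ : α → β → ℝ} (hmeas : ∀ a, Measurable (φ a)) (hcont : ∀ y, Continuous fun a => φ a y)
    {S : Set α} (hS : IsCompact S) (hne : ∀ a ∈ S, ∀ c, ¬ φ a =ᵐ[μ] fun _ => c) :
    ∃ c : ℝ, 0 < c ∧ ∀ a ∈ S, ENNReal.ofReal c ≤ evariance (φ a) μ := by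
  rcases S.eq_empty_or_nonempty with rfl | hSne
  · exact ⟨1, one_pos, by simp⟩
  set D : α → ℝ≥0∞ := fun a => ∫⁻ p, ENNReal.ofReal ((φ a p.1 - φ a p.2) ^ 2) ∂(μ.prod μ)
  have hD : LowerSemicontinuous D := lowerSemicontinuous_lintegral
    (fun a => by have := hmeas a; fun_prop)
    fun p => ENNReal.continuous_ofReal.comp (((hcont p.1).sub (hcont p.2)).pow 2)
  obtain ⟨a₀, ha₀, hmin⟩ := (hD.lowerSemicontinuousOn S).exists_isMinOn hSne hS
  have hpos : 0 < D a₀ / 4 := ENNReal.div_pos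
    (lintegral_prod_sub_sq_ne_zero (hmeas a₀) (hne a₀ ha₀)) (by norm_num)
  obtain ⟨c, hc, hca₀⟩ := ENNReal.lt_iff_exists_nnreal_btwn.1 hpos
  refine ⟨c, by exact_mod_cast hc, fun a ha => ?_⟩
  rw [ENNReal.ofReal_coe_nnreal]
  refine hca₀.le.trans (ENNReal.div_le_of_le_mul' ?_)
  exact (hmin ha).trans (lintegral_prod_sub_sq_le (hmeas a))

end Family

section TrigVariance

open Complex (I)

variable {μ : Measure ℝ}

theorem not_ae_eq_const_of_analytic [NeZero μ] (hμ : μ ≪ volume) {F : ℝ → ℝ}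
    (hF : AnalyticOnNhd ℝ F univ) {y₁ y₂ : ℝ} (hne : F y₁ ≠ F y₂) (c : ℝ) :
    ¬ F =ᵐ[μ] fun _ => c := by
  intro hc
  have hG : AnalyticOnNhd ℝ (fun y => F y - c) univ := hF.sub analyticOnNhd_const
  rcases hG.eqOn_zero_or_eventually_ne_zero_of_preconnected isPreconnected_univ with h | h
  · exact hne ((sub_eq_zero.1 (h (mem_univ y₁))).trans (sub_eq_zero.1 (h (mem_univ y₂))).symm)
  · have hvol := ae_restrict_le_codiscreteWithin (μ := (volume : Measure ℝ)) MeasurableSet.univ h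
    rw [Measure.restrict_univ] at hvol
    obtain ⟨y, hy, hy'⟩ := (hc.and (hμ.ae_le hvol)).exists
    exact hy' (by simp [hy])

variable (ℓ : ℂ →L[ℝ] ℝ) {j : ℕ}

theorem analyticOnNhd_trigDeriv (ω : ℝ) : AnalyticOnNhd ℝ (trigDeriv ℓ j ω) univ := by
  have heq : trigDeriv ℓ j ω = fun y => _ := funext (trigDeriv_eq_cos_add_sin ℓ j ω)
  rw [heq]
  exact fun y _ => by fun_prop

theorem not_ae_eq_const_trigDeriv [NeZero μ] (hμ : μ ≪ volume) (hℓ : ℓ (I ^ j) ≠ 0) {ω : ℝ}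
    (h : j ≠ 0 ∨ ω ≠ 0) (c : ℝ) : ¬ trigDeriv ℓ j ω =ᵐ[μ] fun _ => c := by
  rcases eq_or_ne ω 0 with rfl | hω
  · have hj : j ≠ 0 := h.resolve_right (not_not.2 rfl)
    refine not_ae_eq_const_of_analytic hμ (analyticOnNhd_trigDeriv ℓ 0) (y₁ := 0) (y₂ := 1) ?_ c
    simpa [trigDeriv_eq_cos_add_sin, hj] using hℓ.symm
  · refine not_ae_eq_const_of_analytic hμ (analyticOnNhd_trigDeriv ℓ ω) (y₁ := 0)
      (y₂ := Real.pi / ω) ?_ c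
    rcases eq_or_ne j 0 with rfl | hj
    · simp only [trigDeriv_eq_cos_add_sin, mul_div_cancel₀ _ hω]
      norm_num
      intro h0
      exact hℓ (by rw [pow_zero]; linarith)
    · simp only [trigDeriv_eq_cos_add_sin, mul_div_cancel₀ _ hω]
      simpa [hj, Real.pi_ne_zero, hω] using hℓ

variable {ℓ}

theorem mul_sinc_mul_eq_sin (ω y : ℝ) : ω * (y * Real.sinc (ω * y)) = Real.sin (ω * y) := by
  rcases eq_or_ne (ω * y) 0 with h | h
  · rw [← mul_assoc, h]
    simp
  · rw [Real.sinc_of_ne_zero h, ← mul_assoc, mul_div_cancel₀ _ h]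

theorem trigDeriv_eq_mul_sinc (hℓ : ℓ (I ^ j) = 0) (ω y : ℝ) :
    trigDeriv ℓ j ω y = ω * ℓ (I ^ (j + 1)) * (y ^ (j + 1) * Real.sinc (ω * y)) := by
  rw [trigDeriv_eq_cos_add_sin, hℓ, mul_zero, zero_add, ← mul_sinc_mul_eq_sin]
  ring

theorem abs_trigDeriv_le_abs_mul (hℓ : ℓ (I ^ j) = 0) (ω y : ℝ) :
    |trigDeriv ℓ j ω y| ≤ ‖ℓ‖ * |ω| * |y| ^ (j + 1) := by
  have hI : |ℓ (I ^ (j + 1))| ≤ ‖ℓ‖ := by simpa using ℓ.le_opNorm (I ^ (j + 1))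
  rw [trigDeriv_eq_mul_sinc hℓ, abs_mul, abs_mul, abs_mul, abs_pow]
  calc |ω| * |ℓ (I ^ (j + 1))| * (|y| ^ (j + 1) * |Real.sinc (ω * y)|)
      ≤ |ω| * ‖ℓ‖ * (|y| ^ (j + 1) * 1) := by gcongr; exact Real.abs_sinc_le_one _
    _ = ‖ℓ‖ * |ω| * |y| ^ (j + 1) := by ring

theorem not_ae_eq_const_pow_mul_sinc [NeZero μ] (hμ : μ ≪ volume) (j : ℕ) (ω c : ℝ) :
    ¬ (fun y => y ^ (j + 1) * Real.sinc (ω * y)) =ᵐ[μ] fun _ => c := by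
  intro hc
  rcases eq_or_ne ω 0 with rfl | hω
  · refine not_ae_eq_const_of_analytic hμ (F := fun y => y ^ (j + 1)) (fun y _ => by fun_prop)
      (y₁ := 0) (y₂ := 1) (by simp) c ?_
    simpa using hc
  · refine not_ae_eq_const_of_analytic hμ (F := fun y => y ^ j * Real.sin (ω * y))
      (fun y _ => by fun_prop) (y₁ := 0) (y₂ := Real.pi / 2 / ω) ?_ (ω * c) ?_
    · have hy : (Real.pi / 2 / ω) ^ j ≠ 0 :=
        pow_ne_zero j (div_ne_zero (div_ne_zero Real.pi_ne_zero two_ne_zero) hω)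
      simpa [mul_div_cancel₀ _ hω] using hy.symm
    · filter_upwards [hc] with y hy
      rw [← hy, ← mul_sinc_mul_eq_sin]
      ring

variable [IsProbabilityMeasure μ] {m : ℕ}

theorem exists_pos_le_variance_trigDeriv (hμ : μ ≪ volume) (hm : MemLp id (2 * m : ℕ) μ)
    (hj : j ≤ m) (hℓ : ℓ (I ^ j) ≠ 0) {S : Set ℝ} (hS : IsCompact S) (h : j ≠ 0 ∨ (0 : ℝ) ∉ S) :
    ∃ c : ℝ, 0 < c ∧ ∀ ω ∈ S, c ≤ variance (trigDeriv ℓ j ω) μ := by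
  obtain ⟨c, hc, hle⟩ := exists_pos_le_evariance (μ := μ) (φ := trigDeriv ℓ j)
    (fun ω => (continuous_trigDeriv_right ℓ j ω).measurable) (continuous_trigDeriv_left ℓ j) hS
    fun ω hω => not_ae_eq_const_trigDeriv ℓ hμ hℓ (h.imp_right fun h0 h1 => h0 (h1 ▸ hω))
  refine ⟨c, hc, fun ω hω => ?_⟩
  rw [← ENNReal.ofReal_le_ofReal_iff (variance_nonneg _ _),
    ofReal_variance (memLp_two_trigDeriv ℓ hm hj ω)]
  exact hle ω hω

theorem exists_pos_mul_sq_le_variance_trigDeriv (hμ : μ ≪ volume) (hm : MemLp id (2 * m : ℕ) μ)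
    (hj : j ≤ m) (hℓ : ℓ (I ^ j) = 0) (hℓ' : ℓ (I ^ (j + 1)) ≠ 0) {S : Set ℝ} (hS : IsCompact S) :
    ∃ c : ℝ, 0 < c ∧ ∀ ω ∈ S, c * ω ^ 2 ≤ variance (trigDeriv ℓ j ω) μ := by
  have := Real.continuous_sinc
  obtain ⟨c, hc, hle⟩ := exists_pos_le_evariance (μ := μ)
    (φ := fun ω y => y ^ (j + 1) * Real.sinc (ω * y)) (fun ω => Continuous.measurable (by fun_prop))
    (fun y => by fun_prop) hS fun ω _ => not_ae_eq_const_pow_mul_sinc hμ j ω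
  refine ⟨c * ℓ (I ^ (j + 1)) ^ 2, by positivity, fun ω hω => ?_⟩
  rw [← ENNReal.ofReal_le_ofReal_iff (variance_nonneg _ _),
    ofReal_variance (memLp_two_trigDeriv ℓ hm hj ω), funext (trigDeriv_eq_mul_sinc hℓ ω),
    evariance_mul, mul_pow, mul_assoc, mul_comm, mul_comm (_ ^ 2),
    ENNReal.ofReal_mul (by positivity)]
  gcongr
  exact hle ω hω

end TrigVariance

end Nondegenerate

/-- `X` is square integrable with mean `e` and variance at most `v`. -/
structure MeanVar {Ω : Type*} [MeasurableSpace Ω] (X : Ω → ℝ) (μ : Measure Ω) (e v : ℝ) :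
    Prop where
  memLp : MemLp X 2 μ
  mean : ∫ y, X y ∂μ = e
  variance_le : variance X μ ≤ v

section MeanVar

variable {Ω : Type*} [MeasurableSpace Ω] {μ : Measure Ω}
  {X X' : Ω → ℝ} {e e' v v' : ℝ}

theorem memLp_two_of_lintegral_sq_lt_top (hX : AEStronglyMeasurable X μ)
    (h : ∫⁻ y, ENNReal.ofReal (X y ^ 2) ∂μ < ⊤) : MemLp X 2 μ := by
  refine (memLp_two_iff_integrable_sq hX).2 ⟨hX.pow 2, ?_⟩
  rwa [hasFiniteIntegral_iff_ofReal (.of_forall fun _ => sq_nonneg _)]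

theorem MeanVar.mono (h : MeanVar X μ e v) (hv : v ≤ v') : MeanVar X μ e v' :=
  ⟨h.memLp, h.mean, h.variance_le.trans hv⟩

theorem MeanVar.nonneg (h : MeanVar X μ e v) : 0 ≤ v := (variance_nonneg _ _).trans h.variance_le

theorem MeanVar.const_mul (h : MeanVar X μ e v) (c : ℝ) :
    MeanVar (fun y => c * X y) μ (c * e) (c ^ 2 * v) :=
  ⟨h.memLp.const_mul c, by rw [integral_const_mul, h.mean], by
    rw [variance_const_mul]; exact mul_le_mul_of_nonneg_left h.variance_le (sq_nonneg _)⟩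

theorem MeanVar.comp_of_map_eq {Ω' : Type*} [MeasurableSpace Ω'] {P : Measure Ω'} {Y : Ω' → Ω}
    (hY : Measurable Y) (hmap : P.map Y = μ) (hX : Measurable X) (h : MeanVar X μ e v) :
    MeanVar (X ∘ Y) P e v := by
  subst hmap
  refine ⟨h.memLp.comp_measurePreserving ⟨hY, rfl⟩, ?_, ?_⟩
  · rw [← h.mean, integral_map hY.aemeasurable hX.aestronglyMeasurable]
    rfl
  · rw [← variance_map hX.aemeasurable hY.aemeasurable]
    exact h.variance_le

variable [IsProbabilityMeasure μ]

theorem MeanVar.sum {ι : Type*} (s : Finset ι) {X : ι → Ω → ℝ} {e v : ι → ℝ}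
    (h : ∀ i ∈ s, MeanVar (X i) μ (e i) (v i)) :
    MeanVar (fun y => ∑ i ∈ s, X i y) μ (∑ i ∈ s, e i) (s.card * ∑ i ∈ s, v i) := by
  have hmem : MemLp (fun y => ∑ i ∈ s, X i y) 2 μ := memLp_finsetSum s fun i hi => (h i hi).memLp
  have hmean : ∫ y, ∑ i ∈ s, X i y ∂μ = ∑ i ∈ s, e i := by
    rw [integral_finsetSum _ fun i hi => (h i hi).memLp.integrable one_le_two]
    exact Finset.sum_congr rfl fun i hi => (h i hi).mean
  have hsq : ∀ i ∈ s, Integrable (fun y => (X i y - e i) ^ 2) μ := fun i hi =>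
    ((h i hi).memLp.sub (memLp_const _)).integrable_sq
  have hvar : ∀ i ∈ s, ∫ y, (X i y - e i) ^ 2 ∂μ ≤ v i := fun i hi => by
    have := (h i hi).variance_le
    rwa [variance_eq_integral (h i hi).memLp.aestronglyMeasurable.aemeasurable,
      (h i hi).mean] at this
  refine ⟨hmem, hmean, ?_⟩
  rw [variance_eq_integral hmem.aestronglyMeasurable.aemeasurable, hmean]
  calc ∫ y, (∑ i ∈ s, X i y - ∑ i ∈ s, e i) ^ 2 ∂μ
      ≤ ∫ y, (s.card : ℝ) * ∑ i ∈ s, (X i y - e i) ^ 2 ∂μ := by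
        refine integral_mono (hmem.sub (memLp_const _)).integrable_sq
          ((integrable_finsetSum _ hsq).const_mul _) fun y => ?_
        simp only
        rw [← Finset.sum_sub_distrib]
        exact sq_sum_le_card_mul_sum_sq
    _ = s.card * ∑ i ∈ s, ∫ y, (X i y - e i) ^ 2 ∂μ := by
        rw [integral_const_mul, integral_finsetSum _ hsq]
    _ ≤ _ := by gcongr with i hi; exact hvar i hi

theorem MeanVar.add (h : MeanVar X μ e v) (h' : MeanVar X' μ e' v') :
    MeanVar (fun y => X y + X' y) μ (e + e') (2 * (v + v')) := by
  have := MeanVar.sum (μ := μ) (Finset.univ : Finset (Fin 2)) (X := ![X, X']) (e := ![e, e'])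
    (v := ![v, v']) (fun i _ => by fin_cases i <;> assumption)
  simpa using this

theorem MeanVar.of_lintegral_le (hX : AEStronglyMeasurable X μ) (hmean : ∫ y, X y ∂μ = e)
    (c : ℝ) (hv : 0 ≤ v) (h : ∫⁻ y, ENNReal.ofReal ((X y - c) ^ 2) ∂μ ≤ ENNReal.ofReal v) :
    MeanVar X μ e v := by
  have hXc := hX.sub (aestronglyMeasurable_const (b := c))
  have hm : MemLp (fun y => X y - c) 2 μ :=
    memLp_two_of_lintegral_sq_lt_top hXc (h.trans_lt ENNReal.ofReal_lt_top)
  refine ⟨by simpa [Pi.add_def] using hm.add (memLp_const c), hmean, ?_⟩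
  rw [← variance_sub_const hX c]
  refine (variance_le_expectation_sq hXc).trans ?_
  rw [← ENNReal.ofReal_le_ofReal_iff hv]
  refine le_trans (le_of_eq ?_) h
  exact ofReal_integral_eq_lintegral_ofReal hm.integrable_sq (.of_forall fun y => sq_nonneg _)

theorem lintegral_sq_sub_eq (hX : MemLp X 2 μ) (p : ℝ) :
    ∫⁻ x, ENNReal.ofReal ((X x - p) ^ 2) ∂μ =
      ENNReal.ofReal (variance X μ + ((∫ x, X x ∂μ) - p) ^ 2) := by
  have hXp : MemLp (fun x => X x - p) 2 μ := hX.sub (memLp_const p)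
  have hvar := variance_eq_sub hXp
  rw [variance_sub_const hX.aestronglyMeasurable,
    integral_sub (hX.integrable one_le_two) (integrable_const p)] at hvar
  simp only [integral_const, probReal_univ, smul_eq_mul, one_mul, Pi.pow_apply] at hvar
  rw [← ofReal_integral_eq_lintegral_ofReal hXp.integrable_sq (.of_forall fun _ => sq_nonneg _),
    hvar, sub_add_cancel]

theorem variance_sum_le_of_iIndepFun {P : Measure Ω} [IsProbabilityMeasure P] {ι : Type*}
    [Fintype ι] {X : ι → Ω → ℝ} (hX : ∀ i, MemLp (X i) 2 P) (hind : iIndepFun X P) {v : ℝ}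
    (hv : ∀ i, variance (X i) P ≤ v) :
    variance (fun x => ∑ i, X i x) P ≤ Fintype.card ι * v := by
  have hsum : (fun x => ∑ i, X i x) = ∑ i, X i := by ext; simp
  rw [hsum, IndepFun.variance_sum (fun i _ => hX i) fun i _ j _ hij => hind.indepFun hij]
  calc ∑ i, variance (X i) P ≤ ∑ _i : ι, v := Finset.sum_le_sum fun i _ => hv i
    _ = Fintype.card ι * v := by simp

theorem IsSample.lintegral_sq_mean_sub_le {f g : ℝ → ℝ} {n : ℕ} (hn : 1 ≤ n) {P : Measure Ω}
    [IsProbabilityMeasure P] {Y : Fin n → Ω → ℝ} (hY : IsSample f g P Y) {Z : ℝ → ℝ}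
    (hZm : Measurable Z) {e v : ℝ} (hZ : MeanVar Z (obsLaw f g) e v) (p : ℝ) :
    ∫⁻ x, ENNReal.ofReal (((n : ℝ)⁻¹ * ∑ l, Z (Y l x) - p) ^ 2) ∂P ≤
      ENNReal.ofReal ((n : ℝ)⁻¹ * v + (e - p) ^ 2) := by
  have hn0 : (n : ℝ) ≠ 0 := by positivity
  have hZY : ∀ l, MeanVar (fun x => Z (Y l x)) P e v := fun l =>
    hZ.comp_of_map_eq (hY.measurable l) (hY.law_eq l) hZm
  have hsum : MemLp (fun x => ∑ l, Z (Y l x)) 2 P := memLp_finsetSum _ fun l _ => (hZY l).memLp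
  have hvar : variance (fun x => ∑ l, Z (Y l x)) P ≤ n * v := by
    simpa using variance_sum_le_of_iIndepFun (fun l => (hZY l).memLp)
      (hY.indep.comp (fun _ => Z) fun _ => hZm) fun l => (hZY l).variance_le
  have hmean : ∫ x, ∑ l, Z (Y l x) ∂P = n * e := by
    rw [integral_finsetSum _ fun l _ => (hZY l).memLp.integrable one_le_two]
    simpa using Finset.sum_congr rfl fun l (_ : l ∈ Finset.univ) => (hZY l).mean
  rw [lintegral_sq_sub_eq (hsum.const_mul _), variance_const_mul, integral_const_mul, hmean,
    inv_mul_cancel_left₀ hn0]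
  refine ENNReal.ofReal_le_ofReal (add_le_add ?_ le_rfl)
  calc ((n : ℝ)⁻¹) ^ 2 * variance (fun x => ∑ l, Z (Y l x)) P
      ≤ ((n : ℝ)⁻¹) ^ 2 * (n * v) := by gcongr
    _ = (n : ℝ)⁻¹ * v := by field_simp

theorem ofReal_sq_integral_le_lintegral {ν : Measure Ω} [IsProbabilityMeasure ν] {φ : Ω → ℝ}
    (hφ : AEStronglyMeasurable φ ν) :
    ENNReal.ofReal ((∫ x, φ x ∂ν) ^ 2) ≤ ∫⁻ x, ENNReal.ofReal (φ x ^ 2) ∂ν := by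
  by_cases hmem : MemLp φ 2 ν
  · rw [← ofReal_integral_eq_lintegral_ofReal hmem.integrable_sq (.of_forall fun _ => sq_nonneg _)]
    refine ENNReal.ofReal_le_ofReal ?_
    simpa [variance_eq_sub hmem] using variance_nonneg φ ν
  · have htop : ∫⁻ x, ENNReal.ofReal (φ x ^ 2) ∂ν = ⊤ := by
      by_contra h
      exact hmem (memLp_two_of_lintegral_sq_lt_top hφ (lt_top_iff_ne_top.2 h))
    simp [htop]

theorem lintegral_sq_integral_le_lintegral_prod {α : Type*} [MeasurableSpace α] {ν : Measure α}
    [IsProbabilityMeasure ν] {D : α × Ω → ℝ} (hD : Measurable D) :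
    ∫⁻ y, ENNReal.ofReal ((∫ a, D (a, y) ∂ν) ^ 2) ∂μ ≤
      ∫⁻ p, ENNReal.ofReal (D p ^ 2) ∂(ν.prod μ) := by
  rw [lintegral_prod_symm _ (by fun_prop)]
  exact lintegral_mono fun y =>
    ofReal_sq_integral_le_lintegral (hD.comp measurable_prodMk_right).aestronglyMeasurable

theorem meanVar_integral {α : Type*} [MeasurableSpace α] {ν : Measure α} [IsProbabilityMeasure ν]
    {X : α → Ω → ℝ}
    (hX : Measurable (Function.uncurry X)) (hX2 : ∀ a, MemLp (X a) 2 μ)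
    (hint : ∀ y, Integrable (fun a => X a y) ν)
    (hmean : Integrable (fun a => ∫ y, X a y ∂μ) ν) (hv : 0 ≤ v)
    (hvar : ∫⁻ a, ENNReal.ofReal (variance (X a) μ) ∂ν ≤ ENNReal.ofReal v) :
    MeanVar (fun y => ∫ a, X a y ∂ν) μ (∫ a, ∫ y, X a y ∂μ ∂ν) v := by
  set e : α → ℝ := fun a => ∫ y, X a y ∂μ
  set D : α × Ω → ℝ := fun p => X p.1 p.2 - e p.1
  have hem : Measurable e := hX.stronglyMeasurable.integral_prod_right.measurable
  have hDm : Measurable D := hX.sub (hem.comp measurable_fst)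
  have hDsq : ∫⁻ p, ENNReal.ofReal (D p ^ 2) ∂(ν.prod μ) ≤ ENNReal.ofReal v := by
    rw [lintegral_prod _ (by fun_prop)]
    refine (lintegral_congr fun a => ?_).trans_le hvar
    rw [ofReal_variance (hX2 a), evariance_eq_lintegral_ofReal]
  have hD : Integrable D (ν.prod μ) := (memLp_two_of_lintegral_sq_lt_top
    hDm.aestronglyMeasurable (hDsq.trans_lt ENNReal.ofReal_lt_top)).integrable one_le_two
  have hDy : ∀ y, ∫ a, D (a, y) ∂ν = (∫ a, X a y ∂ν) - ∫ a, e a ∂ν := fun y =>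
    integral_sub (hint y) hmean
  have hcent : ∫ y, ∫ a, D (a, y) ∂ν ∂μ = 0 := by
    rw [← integral_prod_symm D hD, integral_prod D hD]
    refine integral_eq_zero_of_ae (.of_forall fun a => ?_)
    simp [D, e, integral_sub ((hX2 a).integrable one_le_two) (integrable_const _)]
  have hle : ∫⁻ y, ENNReal.ofReal (((∫ a, X a y ∂ν) - ∫ a, e a ∂ν) ^ 2) ∂μ ≤
      ENNReal.ofReal v := by
    simp_rw [← hDy]
    exact (lintegral_sq_integral_le_lintegral_prod hDm).trans hDsq
  have hmeas : AEStronglyMeasurable (fun y => ∫ a, X a y ∂ν) μ :=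
    hX.stronglyMeasurable.integral_prod_left.aestronglyMeasurable
  have h := MeanVar.of_lintegral_le hmeas rfl _ hv hle
  refine ⟨h.memLp, ?_, h.variance_le⟩
  simp_rw [hDy] at hcent
  rw [integral_sub (h.memLp.integrable one_le_two) (integrable_const _)] at hcent
  simpa [sub_eq_zero] using hcent

end MeanVar

section TrigScale

open Complex (I)

variable {ℓ : ℂ →L[ℝ] ℝ} {j : ℕ}

theorem map_I_pow_succ_ne_zero (hℓ : ℓ ≠ 0) (hj : ℓ (I ^ j) = 0) : ℓ (I ^ (j + 1)) ≠ 0 := by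
  intro hj'
  refine hℓ (ContinuousLinearMap.ext fun z => ?_)
  set w := (I ^ j)⁻¹ * z
  have hz : z = w.re • I ^ j + w.im • I ^ (j + 1) := by
    calc z = I ^ j * w := by simp [w]
      _ = I ^ j * (w.re + w.im * I) := by rw [Complex.re_add_im]
      _ = w.re • I ^ j + w.im • I ^ (j + 1) := by
          simp only [Complex.real_smul]
          ring
  rw [hz, map_add, map_smul, map_smul, hj, hj']
  simp

open Classical in
/-- The order of magnitude of `trigDeriv ℓ j ω` as `ω → 0`: it is `ω` when the cosine part of
`trigDeriv ℓ j` vanishes, and `1` otherwise. -/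
noncomputable def trigScale (ℓ : ℂ →L[ℝ] ℝ) (j : ℕ) (ω : ℝ) : ℝ := if ℓ (I ^ j) = 0 then ω else 1

theorem measurable_trigScale (ℓ : ℂ →L[ℝ] ℝ) (j : ℕ) : Measurable (trigScale ℓ j) := by
  unfold trigScale
  split_ifs <;> fun_prop

theorem abs_trigDeriv_le_trigScale (ℓ : ℂ →L[ℝ] ℝ) (j : ℕ) (ω y : ℝ) :
    |trigDeriv ℓ j ω y| ≤ |trigScale ℓ j ω| * (‖ℓ‖ * (|y| ^ j + |y| ^ (j + 1))) := by
  unfold trigScale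
  split_ifs with hℓ
  · calc |trigDeriv ℓ j ω y| ≤ ‖ℓ‖ * |ω| * |y| ^ (j + 1) := abs_trigDeriv_le_abs_mul hℓ ω y
      _ = |ω| * (‖ℓ‖ * (0 + |y| ^ (j + 1))) := by ring
      _ ≤ |ω| * (‖ℓ‖ * (|y| ^ j + |y| ^ (j + 1))) := by gcongr; positivity
  · calc |trigDeriv ℓ j ω y| ≤ ‖ℓ‖ * |y| ^ j := abs_trigDeriv_le ℓ j ω y
      _ = |1| * (‖ℓ‖ * (|y| ^ j + 0)) := by simp
      _ ≤ |1| * (‖ℓ‖ * (|y| ^ j + |y| ^ (j + 1))) := by gcongr; positivity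

variable {μ : Measure ℝ} [IsProbabilityMeasure μ] {m : ℕ}

theorem exists_pos_mul_trigScale_sq_le_variance (hμ : μ ≪ volume) (hm : MemLp id (2 * m : ℕ) μ)
    (hℓ : ℓ ≠ 0) (hj : j ≤ m) {S : Set ℝ} (hS : IsCompact S)
    (h : ℓ (I ^ j) = 0 ∨ j ≠ 0 ∨ (0 : ℝ) ∉ S) :
    ∃ c : ℝ, 0 < c ∧ ∀ ω ∈ S, c * trigScale ℓ j ω ^ 2 ≤ variance (trigDeriv ℓ j ω) μ := by
  by_cases h0 : ℓ (I ^ j) = 0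
  · simpa only [trigScale, h0, if_true] using
      exists_pos_mul_sq_le_variance_trigDeriv hμ hm hj h0 (map_I_pow_succ_ne_zero hℓ h0) hS
  · simpa only [trigScale, h0, if_false, one_pow, mul_one] using
      exists_pos_le_variance_trigDeriv hμ hm hj h0 hS (h.resolve_left h0)

theorem exists_abs_integral_trigDeriv_le (hm : MemLp id m μ) (hj : j + 1 ≤ m) :
    ∃ C : ℝ, ∀ ω, |∫ y, trigDeriv ℓ j ω y ∂μ| ≤ |trigScale ℓ j ω| * C := by
  refine ⟨∫ y, ‖ℓ‖ * (|y| ^ j + |y| ^ (j + 1)) ∂μ, fun ω => ?_⟩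
  rw [← integral_const_mul]
  have hint : Integrable (fun y => ‖ℓ‖ * (|y| ^ j + |y| ^ (j + 1))) μ :=
    ((integrable_abs_pow_of_memLp hm (by omega)).add
      (integrable_abs_pow_of_memLp hm hj)).const_mul _
  exact norm_integral_le_of_norm_le (f := trigDeriv ℓ j ω) (hint.const_mul _)
    (.of_forall fun y => abs_trigDeriv_le_trigScale ℓ j ω y)

theorem continuous_integral_trigDeriv (ℓ : ℂ →L[ℝ] ℝ) (hm : MemLp id m μ) (hj : j ≤ m) :
    Continuous fun ω => ∫ y, trigDeriv ℓ j ω y ∂μ :=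
  continuous_of_dominated (fun ω => (continuous_trigDeriv_right ℓ j ω).aestronglyMeasurable)
    (fun ω => .of_forall fun y => abs_trigDeriv_le ℓ j ω y)
    ((integrable_abs_pow_of_memLp hm hj).const_mul ‖ℓ‖)
    (.of_forall fun y => continuous_trigDeriv_left ℓ j y)

end TrigScale

/-- The standing conditions on the error density `g`, of which `K` is an upper bound. -/
structure ErrorModel (m : ℕ) (g : ℝ → ℝ) (K : ℝ) : Prop where
  pdf : IsPdf g
  bdd : ∀ᵐ x ∂volume, g x ≤ K
  hasMoment : HasMoment (2 * m) g
  im_eq_zero : ∀ ω : ℝ, (fourier g ω).im = 0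
  re_ne_zero : ∀ ω : ℝ, (fourier g ω).re ≠ 0

/-- The conditions on the mixing density `f` that concern only the part `ℓ ∘ f*` (the real or the
imaginary one) and its weight `ψ`. -/
structure PartAdmissible (ℓ : ℂ →L[ℝ] ℝ) (m : ℕ) (g ψ : ℝ → ℝ) (Cσ : ℝ) (f : ℝ → ℝ) : Prop where
  pdf : IsPdf f
  hasMoment : HasMoment (2 * m) f
  integrable : IntegrableOn (fun ω => ψ ω * iteratedDeriv m (fun w => ℓ (fourier f w)) ω) (Ioi 0)
  variance_le : ∀ j ≤ m, ∫⁻ ω in Icc (0 : ℝ) 1,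
    ENNReal.ofReal (variance (fun y => invDeriv g (m - j) ω * ψ ω * trigDeriv ℓ j ω y)
      (obsLaw f g)) ≤ ENNReal.ofReal Cσ

section Leibniz

variable {m : ℕ} {f g ψ₁ ψ₂ : ℝ → ℝ} {K Cσ : ℝ} {ℓ : ℂ →L[ℝ] ℝ}

theorem Admissible.re (h : Admissible m g ψ₁ ψ₂ Cσ f) :
    PartAdmissible Complex.reCLM m g ψ₁ Cσ f where
  pdf := h.pdf
  hasMoment := h.hasMoment
  integrable := h.integrable_re
  variance_le j hj := by
    simpa only [variance_const_mul, mul_pow, trigDeriv_reCLM, sigmaSqRe, sq_abs] using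
      h.variance_re j hj

theorem Admissible.im (h : Admissible m g ψ₁ ψ₂ Cσ f) :
    PartAdmissible Complex.imCLM m g ψ₂ Cσ f where
  pdf := h.pdf
  hasMoment := h.hasMoment
  integrable := h.integrable_im
  variance_le j hj := by
    simpa only [variance_const_mul, mul_pow, trigDeriv_imCLM, sigmaSqIm, sq_abs] using
      h.variance_im j hj

theorem contDiff_fourier {t : ℝ → ℝ} (ht : IsPdf t) (hm : HasMoment (2 * m) t) :
    ContDiff ℝ m (fourier t) := by
  have := isProbabilityMeasure_law ht
  rw [fourier_eq_charFun ht]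
  exact contDiff_charFun ((memLp_id_law ht hm).mono_exponent (by norm_cast; omega))

theorem ErrorModel.contDiff_inv (G : ErrorModel m g K) :
    ContDiff ℝ m (fun w : ℝ => 1 / (fourier g w).re) :=
  contDiff_const.div (Complex.reCLM.contDiff.comp (contDiff_fourier G.pdf G.hasMoment))
    G.re_ne_zero

theorem ErrorModel.continuous_invDeriv (G : ErrorModel m g K) {k : ℕ} (hk : k ≤ m) :
    Continuous (invDeriv g k) :=
  G.contDiff_inv.continuous_iteratedDeriv k (by exact_mod_cast hk)

theorem ErrorModel.memLp_id (G : ErrorModel m g K) (hf : IsPdf f) (hm : HasMoment (2 * m) f) :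
    MemLp id (2 * m : ℕ) (obsLaw f g) := memLp_id_obsLaw hf G.pdf hm G.hasMoment

theorem ErrorModel.clm_comp_fourier (G : ErrorModel m g K) (hf : IsPdf f) :
    (fun w => ℓ (fourier f w)) =
      (fun w => ℓ (charFun (obsLaw f g) w)) * fun w => 1 / (fourier g w).re := by
  ext w
  have hg : fourier g w = (fourier g w).re := Complex.ext rfl (by simp [G.im_eq_zero])
  have hne := G.re_ne_zero w
  have hprod : charFun (obsLaw f g) w = (fourier g w).re • fourier f w := by
    rw [charFun_obsLaw hf G.pdf, Complex.real_smul, ← hg, mul_comm]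
  rw [Pi.mul_apply, hprod, map_smul, smul_eq_mul]
  field_simp

theorem ErrorModel.iteratedDeriv_clm_comp_fourier (G : ErrorModel m g K) (hf : IsPdf f)
    (hm : HasMoment (2 * m) f) {k : ℕ} (hk : k ≤ m) (ω : ℝ) :
    iteratedDeriv k (fun w => ℓ (fourier f w)) ω = ∑ j ∈ Finset.range (k + 1),
      (k.choose j : ℝ) * (invDeriv g (k - j) ω * ∫ y, trigDeriv ℓ j ω y ∂(obsLaw f g)) := by
  have := isProbabilityMeasure_obsLaw hf G.pdf
  have hq := G.memLp_id hf hm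
  have hchar : ContDiff ℝ k (fun w => ℓ (charFun (obsLaw f g) w)) :=
    ℓ.contDiff.comp (contDiff_charFun (hq.mono_exponent (by norm_cast; omega)))
  rw [G.clm_comp_fourier hf, iteratedDeriv_mul hchar.contDiffAt
    (G.contDiff_inv.of_le (by exact_mod_cast hk)).contDiffAt]
  refine Finset.sum_congr rfl fun j hj => ?_
  have hjk := Finset.mem_range_succ_iff.1 hj
  rw [iteratedDeriv_clm_comp_charFun ℓ hq (by omega) ω, invDeriv]
  ring

end Leibniz

section UnitInterval

open Complex (I)

theorem integrable_mul_of_abs_le_mul {α : Type*} [MeasurableSpace α] {ν : Measure α}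
    {w φ ρ : α → ℝ} (hw : Measurable w) (hφ : Measurable φ)
    (h : Integrable (fun x => ρ x * w x) ν) {C : ℝ} (hb : ∀ x, |φ x| ≤ |ρ x| * C) :
    Integrable (fun x => w x * φ x) ν := by
  refine (h.norm.const_mul C).mono' (hw.mul hφ).aestronglyMeasurable (.of_forall fun x => ?_)
  calc ‖w x * φ x‖ = |w x| * |φ x| := abs_mul _ _
    _ ≤ |w x| * (|ρ x| * C) := by gcongr; exact hb x
    _ = C * ‖ρ x * w x‖ := by rw [Real.norm_eq_abs, abs_mul]; ring

theorem integrable_mul_of_mul_sq_le_variance {α : Type*} [MeasurableSpace α] {ν : Measure α}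
    [IsFiniteMeasure ν] {μ : Measure ℝ} {w ρ : α → ℝ} (hw : Measurable w) (hρ : Measurable ρ)
    {X : α → ℝ → ℝ} {c : ℝ} (hc : 0 < c) (hcX : ∀ᵐ x ∂ν, c * ρ x ^ 2 ≤ variance (X x) μ)
    (h : ∫⁻ x, ENNReal.ofReal (variance (fun y => w x * X x y) μ) ∂ν < ⊤) :
    Integrable (fun x => ρ x * w x) ν := by
  refine (memLp_two_of_lintegral_sq_lt_top (hρ.mul hw).aestronglyMeasurable ?_).integrable
    one_le_two
  calc ∫⁻ x, ENNReal.ofReal ((ρ x * w x) ^ 2) ∂ν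
      ≤ ∫⁻ x, ENNReal.ofReal c⁻¹ * ENNReal.ofReal (variance (fun y => w x * X x y) μ) ∂ν := by
        refine lintegral_mono_ae (hcX.mono fun x hx => ?_)
        rw [← ENNReal.ofReal_mul (by positivity), variance_const_mul]
        refine ENNReal.ofReal_le_ofReal ?_
        rw [le_inv_mul_iff₀ hc]
        calc c * (ρ x * w x) ^ 2 = w x ^ 2 * (c * ρ x ^ 2) := by ring
          _ ≤ w x ^ 2 * variance (X x) μ := by gcongr
    _ < ⊤ := by
        rw [lintegral_const_mul' _ _ ENNReal.ofReal_ne_top]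
        exact ENNReal.mul_lt_top ENNReal.ofReal_lt_top h

theorem exists_pos_integrableOn_Icc_of_mul {w e : ℝ → ℝ} {a b : ℝ}
    (h : IntegrableOn (fun ω => w ω * e ω) (Icc a b)) (he : Continuous e) (ha : e a ≠ 0) :
    ∃ δ > a, IntegrableOn w (Icc a δ ∩ Icc a b) := by
  obtain ⟨ε, hε, hball⟩ := Metric.eventually_nhds_iff.1 (he.continuousAt.eventually_ne ha)
  have hne : ∀ ω ∈ Icc a (a + ε / 2) ∩ Icc a b, e ω ≠ 0 := fun ω hω => hball (by
    rw [Real.dist_eq, abs_of_nonneg (by linarith [hω.1.1])]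
    linarith [hω.1.2])
  refine ⟨a + ε / 2, by linarith, ?_⟩
  refine ((h.mono_set inter_subset_right).mul_continuousOn (he.continuousOn.inv₀ hne)
    (isCompact_Icc.inter isCompact_Icc)).congr_fun (fun ω hω => ?_)
    (measurableSet_Icc.inter measurableSet_Icc)
  exact mul_inv_cancel_right₀ (hne ω hω) (w ω)

variable {m : ℕ} {f g ψ : ℝ → ℝ} {K Cσ : ℝ} {ℓ : ℂ →L[ℝ] ℝ} {j : ℕ}

theorem ErrorModel.measurable_invDeriv_mul (G : ErrorModel m g K) (hψ : Measurable ψ) (j : ℕ) :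
    Measurable fun ω => invDeriv g (m - j) ω * ψ ω :=
  (G.continuous_invDeriv (Nat.sub_le m j)).measurable.mul hψ

theorem PartAdmissible.integrableOn_trigScale_Icc (hA : PartAdmissible ℓ m g ψ Cσ f)
    (G : ErrorModel m g K) (hψ : Measurable ψ) (hℓ : ℓ ≠ 0) (hj : j ≤ m) {δ : ℝ} (hδ : 0 ≤ δ)
    (h : ℓ (I ^ j) = 0 ∨ j ≠ 0 ∨ 0 < δ) :
    IntegrableOn (fun ω => trigScale ℓ j ω * (invDeriv g (m - j) ω * ψ ω)) (Icc δ 1) := by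
  have := isProbabilityMeasure_obsLaw hA.pdf G.pdf
  obtain ⟨c, hc, hcv⟩ := exists_pos_mul_trigScale_sq_le_variance
    (obsLaw_absolutelyContinuous hA.pdf G.pdf G.bdd) (G.memLp_id hA.pdf hA.hasMoment) hℓ hj
    (S := Icc δ 1) isCompact_Icc (h.imp_right (Or.imp_right fun h h' => h.not_ge h'.1))
  exact integrable_mul_of_mul_sq_le_variance (G.measurable_invDeriv_mul hψ j)
    (measurable_trigScale ℓ j) hc ((ae_restrict_mem measurableSet_Icc).mono hcv)
    (((lintegral_mono_set (Icc_subset_Icc_left hδ)).trans (hA.variance_le j hj)).trans_lt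
      ENNReal.ofReal_lt_top)

theorem PartAdmissible.integrableOn_mul_integral_of_ne_zero (hA : PartAdmissible ℓ m g ψ Cσ f)
    (G : ErrorModel m g K) (hψ : Measurable ψ) (hℓ : ℓ ≠ 0) (hj : j ≤ m) (hj0 : j ≠ 0) :
    IntegrableOn (fun ω => invDeriv g (m - j) ω * ψ ω * ∫ y, trigDeriv ℓ j ω y ∂(obsLaw f g))
      (Icc 0 1) := by
  have := isProbabilityMeasure_obsLaw hA.pdf G.pdf
  have hq := G.memLp_id hA.pdf hA.hasMoment
  obtain ⟨C, hC⟩ := exists_abs_integral_trigDeriv_le (ℓ := ℓ) (j := j) hq (by omega)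
  exact integrable_mul_of_abs_le_mul (G.measurable_invDeriv_mul hψ j)
    (continuous_integral_trigDeriv ℓ hq (by omega)).measurable
    (hA.integrableOn_trigScale_Icc G hψ hℓ hj le_rfl (.inr (.inl hj0))) hC

theorem PartAdmissible.integrableOn_mul_integral (hA : PartAdmissible ℓ m g ψ Cσ f)
    (G : ErrorModel m g K) (hψ : Measurable ψ) (hℓ : ℓ ≠ 0) (hj : j ≤ m) :
    IntegrableOn (fun ω => invDeriv g (m - j) ω * ψ ω * ∫ y, trigDeriv ℓ j ω y ∂(obsLaw f g))
      (Icc 0 1) := by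
  rcases eq_or_ne j 0 with rfl | hj0
  swap
  · exact hA.integrableOn_mul_integral_of_ne_zero G hψ hℓ hj hj0
  have htotal : IntegrableOn (fun ω => ψ ω * iteratedDeriv m (fun w => ℓ (fourier f w)) ω)
      (Icc 0 1) := by
    rw [integrableOn_Icc_iff_integrableOn_Ioc]
    exact hA.integrable.mono_set Ioc_subset_Ioi_self
  have hrest : IntegrableOn (fun ω => ∑ j ∈ Finset.range m, (m.choose (j + 1) : ℝ) *
      (invDeriv g (m - (j + 1)) ω * ψ ω * ∫ y, trigDeriv ℓ (j + 1) ω y ∂(obsLaw f g)))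
      (Icc 0 1) :=
    integrable_finsetSum _ fun j hj => (hA.integrableOn_mul_integral_of_ne_zero G hψ hℓ
      (Finset.mem_range.1 hj) j.succ_ne_zero).const_mul _
  refine (htotal.sub hrest).congr (.of_forall fun ω => ?_)
  rw [Pi.sub_apply, G.iteratedDeriv_clm_comp_fourier hA.pdf hA.hasMoment le_rfl,
    Finset.sum_range_succ', mul_add, Finset.mul_sum, add_sub_right_comm,
    ← Finset.sum_sub_distrib, Finset.sum_eq_zero fun j _ => by ring]
  simp only [Nat.choose_zero_right, Nat.cast_one]
  ring

/-- The term `j = 0` needs a separate argument when `ℓ 1 ≠ 0`, since then `trigDeriv ℓ 0 0` is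
constant and the variance bound is void at the origin; there the mean of `trigDeriv ℓ 0 ω` does
not vanish and the absolute convergence of `Φ` is used instead. -/
theorem PartAdmissible.integrableOn_trigScale (hA : PartAdmissible ℓ m g ψ Cσ f)
    (G : ErrorModel m g K) (hψ : Measurable ψ) (hℓ : ℓ ≠ 0) (hj : j ≤ m) :
    IntegrableOn (fun ω => trigScale ℓ j ω * (invDeriv g (m - j) ω * ψ ω)) (Icc 0 1) := by
  by_cases h : ℓ (I ^ j) = 0 ∨ j ≠ 0
  · exact hA.integrableOn_trigScale_Icc G hψ hℓ hj le_rfl (by tauto)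
  obtain ⟨hℓ1, rfl⟩ : ℓ (I ^ j) ≠ 0 ∧ j = 0 := by tauto
  have := isProbabilityMeasure_obsLaw hA.pdf G.pdf
  have hq := G.memLp_id hA.pdf hA.hasMoment
  have hmean : ∫ y, trigDeriv ℓ 0 0 y ∂(obsLaw f g) ≠ 0 := by simpa [trigDeriv] using hℓ1
  obtain ⟨δ, hδ, hnear⟩ := exists_pos_integrableOn_Icc_of_mul
    (hA.integrableOn_mul_integral G hψ hℓ hj)
    (continuous_integral_trigDeriv ℓ hq (Nat.zero_le _)) hmean
  have hfar := hA.integrableOn_trigScale_Icc G hψ hℓ hj hδ.le (.inr (.inr hδ))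
  simp only [trigScale, hℓ1, if_false, one_mul] at hfar ⊢
  refine (hnear.union hfar).mono_set fun ω hω => ?_
  exact (le_total ω δ).imp (fun h => ⟨⟨hω.1, h⟩, hω⟩) fun h => ⟨h, hω.2⟩

theorem PartAdmissible.integrableOn_mul_trigDeriv (hA : PartAdmissible ℓ m g ψ Cσ f)
    (G : ErrorModel m g K) (hψ : Measurable ψ) (hℓ : ℓ ≠ 0) (hj : j ≤ m) (y : ℝ) :
    IntegrableOn (fun ω => invDeriv g (m - j) ω * ψ ω * trigDeriv ℓ j ω y) (Icc 0 1) :=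
  integrable_mul_of_abs_le_mul (G.measurable_invDeriv_mul hψ j)
    (continuous_trigDeriv_left ℓ j y).measurable (hA.integrableOn_trigScale G hψ hℓ hj)
    fun ω => abs_trigDeriv_le_trigScale ℓ j ω y

end UnitInterval

section Weights

open Filter Topology

variable {m : ℕ} {a b d C : ℝ} {ψ : ℝ → ℝ} {j : ℕ}

theorem wDeriv_zero (ψ : ℝ → ℝ) : wDeriv 0 ψ = ψ := by
  ext
  simp [wDeriv]

theorem IsWeight.hasDerivWithinAt (h : IsWeight m a b d C ψ) (hj : j < m) {ω : ℝ} (hω : 1 ≤ ω) :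
    HasDerivWithinAt (wDeriv j ψ) (wDeriv (j + 1) ψ ω) (Ici 1) ω := by
  have := (h.differentiable j hj ω hω).hasDerivWithinAt
  unfold wDeriv at *
  rwa [iteratedDerivWithin_succ]

theorem IsWeight.aestronglyMeasurable (h : IsWeight m a b d C ψ) (hj : j ≤ m) :
    AEStronglyMeasurable (wDeriv j ψ) (volume.restrict (Ici 1)) := by
  cases j with
  | zero =>
    rw [wDeriv_zero]
    exact h.measurable.aestronglyMeasurable
  | succ j =>
    refine (stronglyMeasurable_derivWithin_Ici (wDeriv j ψ)).aestronglyMeasurable.congr ?_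
    filter_upwards [ae_restrict_mem measurableSet_Ici] with ω hω
    exact ((h.hasDerivWithinAt (by omega) hω).mono (Ici_subset_Ici.2 hω)).derivWithin
      (uniqueDiffOn_Ici ω ω self_mem_Ici)

theorem IsWeight.const_nonneg (h : IsWeight m a b d C ψ) : 0 ≤ C := by
  have h1 := (abs_nonneg _).trans (h.bound 0 (Nat.zero_le m) 1 le_rfl)
  rw [mul_assoc] at h1
  exact nonneg_of_mul_nonneg_left h1 (by positivity)

theorem IsWeight.abs_le (h : IsWeight m a b d C ψ) (ha : 0 ≤ a) (hd : 0 ≤ d) (hj : j ≤ m)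
    {ω : ℝ} (hω : 1 ≤ ω) : |wDeriv j ψ ω| ≤ C := by
  refine (h.bound j hj ω hω).trans ?_
  have hpow : (ω ^ 2 + 1) ^ (-(a * ((j : ℝ) + 1)) / 2) ≤ 1 := by
    refine Real.rpow_le_one_of_one_le_of_nonpos (by nlinarith) ?_
    have : 0 ≤ a * ((j : ℝ) + 1) := by positivity
    linarith
  have hexp : Real.exp (-d * ω ^ b) ≤ 1 := by
    rw [Real.exp_le_one_iff, neg_mul, neg_nonpos]
    positivity
  rw [mul_assoc]
  exact mul_le_of_le_one_right h.const_nonneg (mul_le_one₀ hpow (Real.exp_pos _).le hexp)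

theorem IsWeight.integrableOn_mul (h : IsWeight m a b d C ψ) (ha : 0 ≤ a) (hd : 0 ≤ d)
    (hj : j ≤ m) {S T : ℝ} (hS : 1 ≤ S) {φ : ℝ → ℝ} (hφ : Continuous φ) :
    IntegrableOn (fun ω => wDeriv j ψ ω * φ ω) (Icc S T) := by
  have hsub : Icc S T ⊆ Ici 1 := fun ω hω => hS.trans hω.1
  refine Integrable.bdd_mul (c := C) hφ.continuousOn.integrableOn_Icc
    ((h.aestronglyMeasurable hj).mono_measure (Measure.restrict_mono hsub le_rfl)) ?_
  filter_upwards [ae_restrict_mem measurableSet_Icc] with ω hω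
  exact h.abs_le ha hd hj (hsub hω)

theorem IsWeight.intervalIntegrable_mul (h : IsWeight m a b d C ψ) (ha : 0 ≤ a) (hd : 0 ≤ d)
    (hj : j ≤ m) {S T : ℝ} (hS : 1 ≤ S) (hST : S ≤ T) {φ : ℝ → ℝ} (hφ : Continuous φ) :
    IntervalIntegrable (fun ω => wDeriv j ψ ω * φ ω) volume S T := by
  rw [intervalIntegrable_iff_integrableOn_Icc_of_le hST]
  exact h.integrableOn_mul ha hd hj hS hφ

variable {u : ℝ → ℝ}

theorem IsWeight.integral_mul_deriv (h : IsWeight m a b d C ψ) (ha : 0 ≤ a) (hd : 0 ≤ d)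
    (hj : j < m) {u' : ℝ → ℝ} (hu : ∀ ω, HasDerivAt u (u' ω) ω) (hu' : Continuous u') {T : ℝ}
    (hT : 1 ≤ T) :
    ∫ ω in (1 : ℝ)..T, wDeriv j ψ ω * u' ω = wDeriv j ψ T * u T - wDeriv j ψ 1 * u 1 -
      ∫ ω in (1 : ℝ)..T, wDeriv (j + 1) ψ ω * u ω := by
  have hsub : uIcc 1 T ⊆ Ici 1 := by
    rw [uIcc_of_le hT]
    exact Icc_subset_Ici_self
  have hw : IntervalIntegrable (wDeriv (j + 1) ψ) volume 1 T := by
    simpa using h.intervalIntegrable_mul ha hd hj le_rfl hT (φ := fun _ => 1) continuous_const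
  refine intervalIntegral.integral_mul_deriv_eq_deriv_mul_of_hasDeriv_right
    ((h.differentiable j hj).continuousOn.mono hsub)
    (fun ω _ => (hu ω).continuousAt.continuousWithinAt) (fun ω hω => ?_)
    (fun ω _ => (hu ω).hasDerivWithinAt) hw (hu'.intervalIntegrable _ _)
  rw [min_eq_left hT] at hω
  exact (h.hasDerivWithinAt hj hω.1.le).mono
    ((Ioi_subset_Ioi hω.1.le).trans Ioi_subset_Ici_self)

theorem IsWeight.integral_mul_iteratedDeriv (h : IsWeight m a b d C ψ) (ha : 0 ≤ a) (hd : 0 ≤ d)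
    (hu : ContDiff ℝ m u) {T : ℝ} (hT : 1 ≤ T) {k : ℕ} (hk : k ≤ m) :
    ∫ ω in (1 : ℝ)..T, ψ ω * iteratedDeriv m u ω =
      (∑ i ∈ Finset.Icc 1 k, (-1) ^ i * (wDeriv (i - 1) ψ 1 * iteratedDeriv (m - i) u 1)) -
      (∑ i ∈ Finset.Icc 1 k, (-1) ^ i * (wDeriv (i - 1) ψ T * iteratedDeriv (m - i) u T)) +
      (-1) ^ k * ∫ ω in (1 : ℝ)..T, wDeriv k ψ ω * iteratedDeriv (m - k) u ω := by
  induction k with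
  | zero => simp [wDeriv_zero]
  | succ k ih =>
    have hder : ∀ ω,
        HasDerivAt (iteratedDeriv (m - (k + 1)) u) (iteratedDeriv (m - k) u ω) ω := fun ω => by
      have := ((hu.differentiable_iteratedDeriv (m - (k + 1))
        (by exact_mod_cast (by omega : m - (k + 1) < m))) ω).hasDerivAt
      rwa [← iteratedDeriv_succ, show m - (k + 1) + 1 = m - k by omega] at this
    rw [ih (by omega), Finset.sum_Icc_succ_top (by omega), Finset.sum_Icc_succ_top (by omega),
      h.integral_mul_deriv ha hd hk hder
        (hu.continuous_iteratedDeriv (m - k) (by exact_mod_cast Nat.sub_le m k)) hT,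
      Nat.add_sub_cancel]
    ring

/-- The integral `∫₀^∞ ψ u^(m)` in which the part over `(1, ∞)` has been integrated by parts `m`
times and cut off at `T`, without the boundary terms at `T`. -/
noncomputable def cutoffIntegral (m : ℕ) (ψ u : ℝ → ℝ) (T : ℝ) : ℝ :=
  (∫ ω in Icc (0 : ℝ) 1, ψ ω * iteratedDeriv m u ω) +
    (∑ k ∈ Finset.Icc 1 m, (-1) ^ k * (wDeriv (k - 1) ψ 1 * iteratedDeriv (m - k) u 1)) +
    (-1) ^ m * ∫ ω in (1 : ℝ)..T, wDeriv m ψ ω * u ω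

theorem IsWeight.integral_mul_iteratedDeriv_eq_cutoffIntegral (h : IsWeight m a b d C ψ)
    (ha : 0 ≤ a) (hd : 0 ≤ d) (hu : ContDiff ℝ m u)
    (hint : IntegrableOn (fun ω => ψ ω * iteratedDeriv m u ω) (Ioi 0)) {T : ℝ} (hT : 1 ≤ T) :
    ∫ ω in (0 : ℝ)..T, ψ ω * iteratedDeriv m u ω = cutoffIntegral m ψ u T -
      ∑ k ∈ Finset.Icc 1 m, (-1) ^ k * (wDeriv (k - 1) ψ T * iteratedDeriv (m - k) u T) := by
  have hii : ∀ {S S' : ℝ}, 0 ≤ S → S ≤ S' →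
      IntervalIntegrable (fun ω => ψ ω * iteratedDeriv m u ω) volume S S' := fun hS hSS' => by
    rw [intervalIntegrable_iff_integrableOn_Ioc_of_le hSS']
    exact hint.mono_set fun x hx => hS.trans_lt hx.1
  rw [← intervalIntegral.integral_add_adjacent_intervals (hii le_rfl zero_le_one)
    (hii zero_le_one hT), intervalIntegral.integral_of_le zero_le_one,
    ← integral_Icc_eq_integral_Ioc, h.integral_mul_iteratedDeriv ha hd hu hT le_rfl,
    Nat.sub_self, iteratedDeriv_zero, cutoffIntegral]
  ring

theorem IsWeight.tendsto_cutoffIntegral (h : IsWeight m a b d C ψ) (ha : 0 ≤ a) (hd : 0 ≤ d)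
    (hu : ContDiff ℝ m u) (hlim : ∀ j ≤ m, Tendsto (iteratedDeriv j u) atTop (𝓝 0))
    (hint : IntegrableOn (fun ω => ψ ω * iteratedDeriv m u ω) (Ioi 0)) :
    Tendsto (cutoffIntegral m ψ u) atTop
      (𝓝 (∫ ω in Ioi (0 : ℝ), ψ ω * iteratedDeriv m u ω)) := by
  have hmain : Tendsto (fun T : ℝ => ∫ ω in (0 : ℝ)..T, ψ ω * iteratedDeriv m u ω) atTop
      (𝓝 (∫ ω in Ioi (0 : ℝ), ψ ω * iteratedDeriv m u ω)) :=
    intervalIntegral_tendsto_integral_Ioi 0 hint tendsto_id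
  have hboundary : Tendsto (fun T : ℝ => ∑ k ∈ Finset.Icc 1 m,
      (-1 : ℝ) ^ k * (wDeriv (k - 1) ψ T * iteratedDeriv (m - k) u T)) atTop (𝓝 0) := by
    rw [← Finset.sum_const_zero (s := Finset.Icc 1 m)]
    refine tendsto_finsetSum _ fun k hk => ?_
    rw [← mul_zero ((-1 : ℝ) ^ k)]
    have hk := Finset.mem_Icc.1 hk
    refine (squeeze_zero_norm' (a := fun T => C * ‖iteratedDeriv (m - k) u T‖) ?_ ?_).const_mul _
    · filter_upwards [eventually_ge_atTop 1] with T hT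
      rw [norm_mul]
      gcongr
      exact h.abs_le ha hd (by omega) hT
    · simpa using (hlim (m - k) (by omega)).norm.const_mul C
  rw [← add_zero (∫ ω in Ioi (0 : ℝ), ψ ω * iteratedDeriv m u ω)]
  refine (hmain.add hboundary).congr' ?_
  filter_upwards [eventually_ge_atTop 1] with T hT
  rw [h.integral_mul_iteratedDeriv_eq_cutoffIntegral ha hd hu hint hT, sub_add_cancel]

theorem cutoffIntegral_sub {S T : ℝ}
    (hS : IntervalIntegrable (fun ω => wDeriv m ψ ω * u ω) volume 1 S)
    (hT : IntervalIntegrable (fun ω => wDeriv m ψ ω * u ω) volume 1 T) :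
    cutoffIntegral m ψ u T - cutoffIntegral m ψ u S =
      (-1) ^ m * ∫ ω in S..T, wDeriv m ψ ω * u ω := by
  rw [← intervalIntegral.integral_interval_sub_left hT hS, cutoffIntegral, cutoffIntegral]
  ring

theorem IsWeight.abs_cutoffIntegral_sub_eq (h : IsWeight m a b d C ψ) (ha : 0 ≤ a) (hd : 0 ≤ d)
    (hu : Continuous u) {S T : ℝ} (hS : 1 ≤ S) (hT : 1 ≤ T) :
    |cutoffIntegral m ψ u T - cutoffIntegral m ψ u S| = |∫ ω in S..T, wDeriv m ψ ω * u ω| := by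
  rw [cutoffIntegral_sub (h.intervalIntegrable_mul ha hd le_rfl le_rfl hS hu)
    (h.intervalIntegrable_mul ha hd le_rfl le_rfl hT hu), abs_mul, abs_pow, abs_neg, abs_one,
    one_pow, one_mul]

theorem IsWeight.abs_cutoffIntegral_sub_le (h : IsWeight m a b d C ψ) (ha : 0 ≤ a) (hd : 0 ≤ d)
    (hu : Continuous u) {L : ℝ} (hL : Tendsto (cutoffIntegral m ψ u) atTop (𝓝 L)) {H R : ℝ}
    (hH : 1 ≤ H) (hR : ∀ T, H ≤ T → |∫ ω in H..T, wDeriv m ψ ω * u ω| ≤ R) :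
    |cutoffIntegral m ψ u H - L| ≤ R := by
  refine le_of_tendsto (hL.const_sub _).abs ?_
  filter_upwards [eventually_ge_atTop H] with T hT
  rw [abs_sub_comm, h.abs_cutoffIntegral_sub_eq ha hd hu hH (hH.trans hT)]
  exact hR T hT

theorem IsWeight.exists_abs_cutoffIntegral_sub_le (h : IsWeight m a b d C ψ) (ha : 0 ≤ a)
    (hd : 0 ≤ d) (hu : Continuous u) {L : ℝ}
    (hL : Tendsto (cutoffIntegral m ψ u) atTop (𝓝 L)) :
    ∃ R, ∀ H : ℝ, 1 ≤ H → |cutoffIntegral m ψ u H - L| ≤ R := by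
  have hlim : Tendsto (fun T => |cutoffIntegral m ψ u T - L|) atTop (𝓝 0) := by
    simpa using (hL.sub_const L).abs
  obtain ⟨T₀, hT₀⟩ := eventually_atTop.1 (hlim.eventually_le_const one_pos)
  set T := max T₀ 1
  have hT : 1 ≤ T := le_max_right T₀ 1
  have hint := h.intervalIntegrable_mul ha hd le_rfl le_rfl hT hu
  set W := ∫ ω in (1 : ℝ)..T, |wDeriv m ψ ω * u ω|
  have hW : 0 ≤ W := intervalIntegral.integral_nonneg hT fun ω _ => abs_nonneg _
  refine ⟨|cutoffIntegral m ψ u 1 - L| + W + 1, fun H hH => ?_⟩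
  rcases le_total H T with hHT | hHT
  · have hle : |cutoffIntegral m ψ u H - cutoffIntegral m ψ u 1| ≤ W := by
      rw [h.abs_cutoffIntegral_sub_eq ha hd hu le_rfl hH]
      exact (intervalIntegral.abs_integral_le_integral_abs hH).trans
        (intervalIntegral.integral_mono_interval le_rfl hH hHT
          (.of_forall fun ω => abs_nonneg _) hint.abs)
    linarith [abs_sub_le (cutoffIntegral m ψ u H) (cutoffIntegral m ψ u 1) L]
  · linarith [hT₀ H ((le_max_left T₀ 1).trans hHT), abs_nonneg (cutoffIntegral m ψ u 1 - L)]

end Weights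

section RiemannLebesgue

open Filter Topology

variable {m : ℕ} {f : ℝ → ℝ}

theorem tendsto_iteratedDeriv_fourier (hf : IsPdf f) (hm : HasMoment (2 * m) f) {j : ℕ}
    (hj : j ≤ 2 * m) : Tendsto (iteratedDeriv j (fourier f)) atTop (𝓝 0) := by
  have := isProbabilityMeasure_law hf
  have hcoc : Tendsto (fun ω : ℝ => -ω / (2 * Real.pi)) atTop (cocompact ℝ) :=
    ((tendsto_neg_atTop_atBot).atBot_div_const (by positivity)).mono_right atBot_le_cocompact
  have hlim := ((Real.tendsto_integral_exp_smul_cocompact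
    (fun x : ℝ => (f x : ℂ) * ((x : ℂ) ^ j))).comp hcoc).const_mul (Complex.I ^ j)
  rw [mul_zero] at hlim
  refine hlim.congr fun ω => ?_
  rw [fourier_eq_charFun hf, iteratedDeriv_charFun
    ((memLp_id_law hf hm).mono_exponent (by exact_mod_cast hj)), integral_law hf]
  congr 1
  refine integral_congr_ae (.of_forall fun x => ?_)
  simp only [Circle.smul_def, Real.fourierChar_apply, Complex.real_smul, smul_eq_mul]
  rw [mul_comm, mul_assoc]
  congr 3
  have hpi : (Real.pi : ℂ) ≠ 0 := by exact_mod_cast Real.pi_ne_zero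
  push_cast
  field_simp

theorem continuous_clm_comp_fourier (ℓ : ℂ →L[ℝ] ℝ) (hf : IsPdf f) :
    Continuous fun w => ℓ (fourier f w) := by
  have := isProbabilityMeasure_law hf
  rw [fourier_eq_charFun hf]
  exact ℓ.continuous.comp continuous_charFun

theorem tendsto_cutoffIntegral_clm_comp_fourier {ℓ : ℂ →L[ℝ] ℝ} {g ψ : ℝ → ℝ}
    {a b d C Cσ : ℝ} (hA : PartAdmissible ℓ m g ψ Cσ f) (hψ : IsWeight m a b d C ψ) (ha : 0 ≤ a)
    (hd : 0 ≤ d) :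
    Tendsto (cutoffIntegral m ψ fun w => ℓ (fourier f w)) atTop
      (𝓝 (∫ ω in Ioi (0 : ℝ), ψ ω * iteratedDeriv m (fun w => ℓ (fourier f w)) ω)) := by
  have hf := contDiff_fourier hA.pdf hA.hasMoment
  refine hψ.tendsto_cutoffIntegral ha hd (ℓ.contDiff.comp hf) (fun j hj => ?_) hA.integrable
  have hlim := (ℓ.continuous.tendsto 0).comp
    (tendsto_iteratedDeriv_fourier hA.pdf hA.hasMoment (by omega : j ≤ 2 * m))
  rw [map_zero] at hlim
  exact hlim.congr fun ω =>
    (iteratedDeriv_clm_comp ℓ (hf.of_le (by exact_mod_cast hj)).contDiffAt).symm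

end RiemannLebesgue

section TailIntegral

variable {μ : Measure ℝ} [IsProbabilityMeasure μ] {S : Set ℝ} {κ : ℝ → ℝ} (ℓ : ℂ →L[ℝ] ℝ)

theorem integrableOn_mul_trigDeriv_zero (hκ : IntegrableOn κ S) (y : ℝ) :
    IntegrableOn (fun ω => κ ω * trigDeriv ℓ 0 ω y) S :=
  hκ.mul_bdd (c := ‖ℓ‖) (continuous_trigDeriv_left ℓ 0 y).aestronglyMeasurable
    (.of_forall fun ω => by simpa using abs_trigDeriv_le ℓ 0 ω y)

theorem continuous_setIntegral_mul_trigDeriv_zero (hκ : IntegrableOn κ S) :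
    Continuous fun y => ∫ ω in S, κ ω * trigDeriv ℓ 0 ω y := by
  refine continuous_of_dominated (bound := fun ω => ‖κ ω‖ * ‖ℓ‖)
    (fun y => (integrableOn_mul_trigDeriv_zero ℓ hκ y).1) (fun y => .of_forall fun ω => ?_)
    (hκ.norm.mul_const _)
    (.of_forall fun ω => continuous_const.mul (continuous_trigDeriv_right ℓ 0 ω))
  rw [norm_mul]
  gcongr
  simpa using abs_trigDeriv_le ℓ 0 ω y

theorem integral_setIntegral_mul_trigDeriv_zero (hκ : IntegrableOn κ S) :
    ∫ y, (∫ ω in S, κ ω * trigDeriv ℓ 0 ω y) ∂μ = ∫ ω in S, κ ω * ∫ y, trigDeriv ℓ 0 ω y ∂μ := by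
  have hint : Integrable (fun p : ℝ × ℝ => κ p.2 * trigDeriv ℓ 0 p.2 p.1)
      (μ.prod (volume.restrict S)) :=
    (hκ.comp_snd μ).mul_bdd (c := ‖ℓ‖)
      ((continuous_trigDeriv ℓ 0).comp continuous_swap).aestronglyMeasurable
      (.of_forall fun p => by simpa using abs_trigDeriv_le ℓ 0 p.2 p.1)
  rw [integral_integral_swap (f := fun y ω => κ ω * trigDeriv ℓ 0 ω y) hint]
  simp_rw [integral_const_mul]

theorem meanVar_setIntegral_mul_trigDeriv_zero {K : ℝ} (hK : 0 ≤ K)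
    (hμ : μ ≤ ENNReal.ofReal K • (volume : Measure ℝ)) (hS : MeasurableSet S)
    (hκ : IntegrableOn κ S) (hκ2 : MemLp κ 2 (volume.restrict S)) :
    MeanVar (fun y => ∫ ω in S, κ ω * trigDeriv ℓ 0 ω y) μ
      (∫ ω in S, κ ω * ∫ y, trigDeriv ℓ 0 ω y ∂μ)
      (‖ℓ‖ ^ 2 * (K * (2 * Real.pi)) * ∫ ω in S, κ ω ^ 2) := by
  refine MeanVar.of_lintegral_le
    (continuous_setIntegral_mul_trigDeriv_zero ℓ hκ).aestronglyMeasurable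
    (integral_setIntegral_mul_trigDeriv_zero ℓ hκ) 0 ?_ ?_
  · have : 0 ≤ ∫ ω in S, κ ω ^ 2 := integral_nonneg fun ω => sq_nonneg _
    positivity
  · simpa only [sub_zero] using lintegral_sq_setIntegral_trigDeriv_zero_le ℓ hK hμ hS hκ hκ2

end TailIntegral

section Observation

variable {m : ℕ} {f g ψ ψ₁ ψ₂ : ℝ → ℝ} {K Cσ a b d C T h : ℝ} {ℓ : ℂ →L[ℝ] ℝ} {n : ℕ}

/-- The contribution of one observation `y` to the part of `PhiHat1` that estimates
`∫₀¹ ψ (ℓ ∘ f*)^(m)`. -/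
noncomputable def unitObs (ℓ : ℂ →L[ℝ] ℝ) (m : ℕ) (g ψ : ℝ → ℝ) (y : ℝ) : ℝ :=
  ∑ j ∈ Finset.range (m + 1), (m.choose j : ℝ) *
    ∫ ω in Icc (0 : ℝ) 1, invDeriv g (m - j) ω * ψ ω * trigDeriv ℓ j ω y

/-- The contribution of one observation `y` to the part of `FHat` that belongs to `ℓ ∘ f*`. -/
noncomputable def boundaryObs (ℓ : ℂ →L[ℝ] ℝ) (m : ℕ) (g ψ : ℝ → ℝ) (y : ℝ) : ℝ :=
  ∑ k ∈ Finset.Icc 1 m, ∑ j ∈ Finset.range (m - k + 1),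
    (-1) ^ k * ((m - k).choose j : ℝ) * (coefA m j k g ψ 1 * trigDeriv ℓ j 1 y)

/-- The weight `ψ^(m) / g*` of the empirical characteristic function in `PhiHat20`. -/
noncomputable def tailWeight (m : ℕ) (g ψ : ℝ → ℝ) (ω : ℝ) : ℝ :=
  wDeriv m ψ ω * (1 / (fourier g ω).re)

/-- The contribution of one observation `y` to the part of `PhiHat20` that belongs to `ℓ ∘ f*`,
with cutoff frequency `T = 1 / h`. -/
noncomputable def tailObs (ℓ : ℂ →L[ℝ] ℝ) (m : ℕ) (g ψ : ℝ → ℝ) (T y : ℝ) : ℝ :=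
  (-1) ^ m * ∫ ω in Icc 1 T, tailWeight m g ψ ω * trigDeriv ℓ 0 ω y

/-- The contribution of one observation `y` to the part of `PhiHat` that estimates
`∫₀^∞ ψ (ℓ ∘ f*)^(m)`, with cutoff frequency `T = 1 / h`. -/
noncomputable def partObs (ℓ : ℂ →L[ℝ] ℝ) (m : ℕ) (g ψ : ℝ → ℝ) (T y : ℝ) : ℝ :=
  unitObs ℓ m g ψ y + boundaryObs ℓ m g ψ y + tailObs ℓ m g ψ T y

theorem reCLM_ne_zero : Complex.reCLM ≠ 0 := fun h => by simpa using DFunLike.congr_fun h 1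

theorem imCLM_ne_zero : Complex.imCLM ≠ 0 := fun h => by simpa using DFunLike.congr_fun h Complex.I

theorem integrand1_eq (y : Fin n → ℝ) (j : ℕ) (ω : ℝ) :
    integrand1 m g ψ₁ ψ₂ y j ω = (n : ℝ)⁻¹ *
      ∑ l, (invDeriv g (m - j) ω * ψ₁ ω * trigDeriv Complex.reCLM j ω (y l) +
        invDeriv g (m - j) ω * ψ₂ ω * trigDeriv Complex.imCLM j ω (y l)) := by
  rw [integrand1, uHatRe, uHatIm, Finset.sum_add_distrib, ← Finset.mul_sum, ← Finset.mul_sum,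
    trigDeriv_reCLM, trigDeriv_imCLM]
  ring

theorem integrand2_eq (y : Fin n → ℝ) (ω : ℝ) :
    integrand2 m g ψ₁ ψ₂ y ω = (n : ℝ)⁻¹ *
      ∑ l, (tailWeight m g ψ₁ ω * trigDeriv Complex.reCLM 0 ω (y l) +
        tailWeight m g ψ₂ ω * trigDeriv Complex.imCLM 0 ω (y l)) := by
  rw [integrand2, uHatRe, uHatIm, Finset.sum_add_distrib, ← Finset.mul_sum, ← Finset.mul_sum,
    trigDeriv_reCLM, trigDeriv_imCLM, tailWeight, tailWeight]
  ring

theorem ErrorModel.integrableOn_tailWeight (G : ErrorModel m g K) (hψ : IsWeight m a b d C ψ)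
    (ha : 0 ≤ a) (hd : 0 ≤ d) (T : ℝ) : IntegrableOn (tailWeight m g ψ) (Icc 1 T) :=
  hψ.integrableOn_mul ha hd le_rfl le_rfl G.contDiff_inv.continuous

theorem ErrorModel.integrableOn_integrand1 (G : ErrorModel m g K)
    (hA : Admissible m g ψ₁ ψ₂ Cσ f) (h₁ : Measurable ψ₁) (h₂ : Measurable ψ₂)
    (y : Fin n → ℝ) {j : ℕ} (hj : j ≤ m) :
    IntegrableOn (integrand1 m g ψ₁ ψ₂ y j) (Icc 0 1) := by
  rw [funext (integrand1_eq y j)]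
  exact (integrable_finsetSum _ fun l _ =>
    (hA.re.integrableOn_mul_trigDeriv G h₁ reCLM_ne_zero hj (y l)).add
      (hA.im.integrableOn_mul_trigDeriv G h₂ imCLM_ne_zero hj (y l))).const_mul _

theorem ErrorModel.integrableOn_integrand2 (G : ErrorModel m g K)
    (h₁ : IsWeight m a b d C ψ₁) (h₂ : IsWeight m a b d C ψ₂) (ha : 0 ≤ a) (hd : 0 ≤ d)
    (y : Fin n → ℝ) (T : ℝ) : IntegrableOn (integrand2 m g ψ₁ ψ₂ y) (Icc 1 T) := by
  rw [funext (integrand2_eq y)]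
  exact (integrable_finsetSum _ fun l _ =>
    (integrableOn_mul_trigDeriv_zero _ (G.integrableOn_tailWeight h₁ ha hd T) (y l)).add
      (integrableOn_mul_trigDeriv_zero _ (G.integrableOn_tailWeight h₂ ha hd T) (y l))).const_mul _

theorem ErrorModel.PhiHat1_eq (G : ErrorModel m g K) (hA : Admissible m g ψ₁ ψ₂ Cσ f)
    (h₁ : Measurable ψ₁) (h₂ : Measurable ψ₂) (y : Fin n → ℝ) :
    PhiHat1 m g ψ₁ ψ₂ y = (n : ℝ)⁻¹ *
      ∑ l, (unitObs Complex.reCLM m g ψ₁ (y l) + unitObs Complex.imCLM m g ψ₂ (y l)) := by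
  simp only [PhiHat1, unitObs, ← Finset.sum_add_distrib]
  rw [Finset.sum_comm, Finset.mul_sum]
  refine Finset.sum_congr rfl fun j hj => ?_
  have hjm := Finset.mem_range_succ_iff.1 hj
  have hre := fun l => hA.re.integrableOn_mul_trigDeriv G h₁ reCLM_ne_zero hjm (y l)
  have him := fun l => hA.im.integrableOn_mul_trigDeriv G h₂ imCLM_ne_zero hjm (y l)
  rw [intervalIntegral.integral_of_le zero_le_one, ← integral_Icc_eq_integral_Ioc]
  simp_rw [integrand1_eq, integral_const_mul]
  rw [integral_finsetSum _ fun l _ => by exact (hre l).add (him l)]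
  simp_rw [integral_add (hre _) (him _), ← mul_add]
  rw [← Finset.mul_sum, mul_left_comm]

theorem FHat_eq (y : Fin n → ℝ) :
    FHat m g ψ₁ ψ₂ y = (n : ℝ)⁻¹ *
      ∑ l, (boundaryObs Complex.reCLM m g ψ₁ (y l) + boundaryObs Complex.imCLM m g ψ₂ (y l)) := by
  simp only [FHat, boundaryObs, ← Finset.sum_add_distrib]
  rw [Finset.sum_comm, Finset.mul_sum]
  refine Finset.sum_congr rfl fun k _ => ?_
  rw [Finset.sum_comm, Finset.mul_sum]
  refine Finset.sum_congr rfl fun j _ => ?_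
  simp_rw [← mul_add]
  rw [← Finset.mul_sum, Finset.sum_add_distrib, ← Finset.mul_sum, ← Finset.mul_sum, uHatRe,
    uHatIm, trigDeriv_reCLM, trigDeriv_imCLM]
  ring

theorem ErrorModel.PhiHat20_eq (G : ErrorModel m g K)
    (h₁ : IsWeight m a b d C ψ₁) (h₂ : IsWeight m a b d C ψ₂) (ha : 0 ≤ a) (hd : 0 ≤ d)
    (hT : 1 ≤ 1 / h) (y : Fin n → ℝ) :
    PhiHat20 m g ψ₁ ψ₂ h y = (n : ℝ)⁻¹ * ∑ l, (tailObs Complex.reCLM m g ψ₁ (1 / h) (y l) +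
      tailObs Complex.imCLM m g ψ₂ (1 / h) (y l)) := by
  have hre := fun l => integrableOn_mul_trigDeriv_zero Complex.reCLM
    (G.integrableOn_tailWeight h₁ ha hd (1 / h)) (y l)
  have him := fun l => integrableOn_mul_trigDeriv_zero Complex.imCLM
    (G.integrableOn_tailWeight h₂ ha hd (1 / h)) (y l)
  simp only [PhiHat20, tailObs]
  rw [intervalIntegral.integral_of_le hT, ← integral_Icc_eq_integral_Ioc]
  simp_rw [integrand2_eq, integral_const_mul]
  rw [integral_finsetSum _ fun l _ => by exact (hre l).add (him l)]
  simp_rw [integral_add (hre _) (him _), ← mul_add]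
  rw [← Finset.mul_sum, mul_left_comm]

theorem ErrorModel.PhiHat_eq (G : ErrorModel m g K) (hA : Admissible m g ψ₁ ψ₂ Cσ f)
    (h₁ : IsWeight m a b d C ψ₁) (h₂ : IsWeight m a b d C ψ₂) (ha : 0 ≤ a) (hd : 0 ≤ d)
    (hT : 1 ≤ 1 / h) (y : Fin n → ℝ) :
    PhiHat m g ψ₁ ψ₂ h y = (n : ℝ)⁻¹ * ∑ l, (partObs Complex.reCLM m g ψ₁ (1 / h) (y l) +
      partObs Complex.imCLM m g ψ₂ (1 / h) (y l)) := by
  rw [PhiHat, G.PhiHat1_eq hA h₁.measurable h₂.measurable, FHat_eq,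
    G.PhiHat20_eq h₁ h₂ ha hd hT, ← mul_add, ← mul_add, ← Finset.sum_add_distrib,
    ← Finset.sum_add_distrib]
  simp only [partObs]
  congr! 2
  ring

theorem ErrorModel.measurable_partObs (G : ErrorModel m g K) (hψ : IsWeight m a b d C ψ)
    (ha : 0 ≤ a) (hd : 0 ≤ d) (T : ℝ) : Measurable (partObs ℓ m g ψ T) := by
  refine Measurable.add (Measurable.add ?_ ?_) ?_
  · refine Finset.measurable_fun_sum _ fun j _ => Measurable.const_mul ?_ _
    exact ((((G.measurable_invDeriv_mul hψ.measurable j).comp measurable_snd).mul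
      ((continuous_trigDeriv ℓ j).measurable.comp
        measurable_swap)).stronglyMeasurable.integral_prod_right).measurable
  · exact Finset.measurable_fun_sum _ fun k _ => Finset.measurable_fun_sum _ fun j _ =>
      ((continuous_trigDeriv_right ℓ j 1).measurable.const_mul _).const_mul _
  · exact (continuous_setIntegral_mul_trigDeriv_zero ℓ
      (G.integrableOn_tailWeight hψ ha hd T)).measurable.const_mul _

end Observation

section ObservationVariance

variable {m : ℕ} {f g ψ : ℝ → ℝ} {K Cσ a b d C T M α β γ C₁ C₂ : ℝ} {ℓ : ℂ →L[ℝ] ℝ}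

theorem variance_trigDeriv_le {μ : Measure ℝ} [IsProbabilityMeasure μ]
    (hm : MemLp id (2 * m : ℕ) μ) {j : ℕ} (hj : j ≤ m) (ω : ℝ) :
    variance (trigDeriv ℓ j ω) μ ≤ ‖ℓ‖ ^ 2 * (1 + ∫ y, y ^ (2 * m) ∂μ) := by
  have hpow := integrable_pow_of_memLp hm le_rfl
  have hle : ∀ y, (trigDeriv ℓ j ω y) ^ 2 ≤ ‖ℓ‖ ^ 2 * (1 + y ^ (2 * m)) := fun y => by
    have hyj : (|y| ^ j) ^ 2 ≤ 1 + y ^ (2 * m) := by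
      rw [← (even_two_mul m).pow_abs y, ← pow_mul, mul_comm j 2]
      rcases le_total |y| 1 with h | h
      · exact (pow_le_one₀ (abs_nonneg _) h).trans (le_add_of_nonneg_right (by positivity))
      · exact (pow_le_pow_right₀ h (by omega)).trans (le_add_of_nonneg_left zero_le_one)
    calc (trigDeriv ℓ j ω y) ^ 2 = |trigDeriv ℓ j ω y| ^ 2 := (sq_abs _).symm
      _ ≤ (‖ℓ‖ * |y| ^ j) ^ 2 := by gcongr; exact abs_trigDeriv_le ℓ j ω y
      _ ≤ ‖ℓ‖ ^ 2 * (1 + y ^ (2 * m)) := by rw [mul_pow]; gcongr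
  have hX := memLp_two_trigDeriv ℓ hm hj ω
  calc variance (trigDeriv ℓ j ω) μ ≤ ∫ y, (trigDeriv ℓ j ω y) ^ 2 ∂μ :=
        variance_le_expectation_sq hX.aestronglyMeasurable
    _ ≤ ∫ y, ‖ℓ‖ ^ 2 * (1 + y ^ (2 * m)) ∂μ :=
        integral_mono hX.integrable_sq (((integrable_const 1).add hpow).const_mul _) hle
    _ = ‖ℓ‖ ^ 2 * (1 + ∫ y, y ^ (2 * m) ∂μ) := by
        rw [integral_const_mul, integral_add (integrable_const 1) hpow]
        simp

theorem ErrorModel.meanVar_trigDeriv (G : ErrorModel m g K) (hf : IsPdf f)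
    (hfm : HasMoment (2 * m) f) (hM : moment (2 * m) f ≤ M) {j : ℕ} (hj : j ≤ m) (ω : ℝ) :
    MeanVar (trigDeriv ℓ j ω) (obsLaw f g) (∫ y, trigDeriv ℓ j ω y ∂(obsLaw f g))
      (‖ℓ‖ ^ 2 * (1 + 2 ^ (2 * m - 1) * (M + moment (2 * m) g))) := by
  have := isProbabilityMeasure_obsLaw hf G.pdf
  have hq := G.memLp_id hf hfm
  refine ⟨memLp_two_trigDeriv ℓ hq hj ω, rfl, (variance_trigDeriv_le hq hj ω).trans ?_⟩
  gcongr
  exact (integral_pow_obsLaw_le hf G.pdf hfm G.hasMoment).trans (by gcongr)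

theorem PartAdmissible.meanVar_unitObs (hA : PartAdmissible ℓ m g ψ Cσ f) (G : ErrorModel m g K)
    (hψ : Measurable ψ) (hℓ : ℓ ≠ 0) :
    MeanVar (unitObs ℓ m g ψ) (obsLaw f g)
      (∫ ω in Icc (0 : ℝ) 1, ψ ω * iteratedDeriv m (fun w => ℓ (fourier f w)) ω)
      ((m + 1) * ∑ j ∈ Finset.range (m + 1), (m.choose j : ℝ) ^ 2 * max Cσ 0) := by
  have := isProbabilityMeasure_obsLaw hA.pdf G.pdf
  have : IsProbabilityMeasure (volume.restrict (Icc (0 : ℝ) 1)) := ⟨by simp⟩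
  have hq := G.memLp_id hA.pdf hA.hasMoment
  have hterm : ∀ j ∈ Finset.range (m + 1), MeanVar
      (fun y => ∫ ω in Icc (0 : ℝ) 1, invDeriv g (m - j) ω * ψ ω * trigDeriv ℓ j ω y)
      (obsLaw f g) (∫ ω in Icc (0 : ℝ) 1, invDeriv g (m - j) ω * ψ ω *
        ∫ y, trigDeriv ℓ j ω y ∂(obsLaw f g)) (max Cσ 0) := fun j hj => by
    have hjm := Finset.mem_range_succ_iff.1 hj
    simp_rw [← integral_const_mul]
    refine meanVar_integral (X := fun ω y => invDeriv g (m - j) ω * ψ ω * trigDeriv ℓ j ω y)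
      (((G.measurable_invDeriv_mul hψ j).comp measurable_fst).mul
        (continuous_trigDeriv ℓ j).measurable)
      (fun ω => (memLp_two_trigDeriv ℓ hq hjm ω).const_mul _)
      (hA.integrableOn_mul_trigDeriv G hψ hℓ hjm) ?_ (le_max_right _ _)
      ((hA.variance_le j hjm).trans (ENNReal.ofReal_le_ofReal (le_max_left _ _)))
    simp_rw [integral_const_mul]
    exact hA.integrableOn_mul_integral G hψ hℓ hjm
  have hsum := MeanVar.sum _ fun j hj => (hterm j hj).const_mul (m.choose j : ℝ)
  refine ⟨hsum.memLp, hsum.mean.trans ?_, hsum.variance_le.trans_eq (by simp)⟩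
  simp_rw [G.iteratedDeriv_clm_comp_fourier hA.pdf hA.hasMoment le_rfl, Finset.mul_sum]
  rw [integral_finsetSum]
  · refine Finset.sum_congr rfl fun j _ => ?_
    rw [← integral_const_mul]
    exact integral_congr_ae (.of_forall fun ω => by ring)
  · intro j hj
    refine ((hA.integrableOn_mul_integral G hψ hℓ (Finset.mem_range_succ_iff.1 hj)).const_mul
      (m.choose j : ℝ)).congr (.of_forall fun ω => by ring)

theorem ErrorModel.exists_meanVar_boundaryObs (G : ErrorModel m g K) (ℓ : ℂ →L[ℝ] ℝ)
    (ψ : ℝ → ℝ) (M : ℝ) :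
    ∃ v, ∀ f, IsPdf f → HasMoment (2 * m) f → moment (2 * m) f ≤ M →
      MeanVar (boundaryObs ℓ m g ψ) (obsLaw f g) (∑ k ∈ Finset.Icc 1 m, (-1) ^ k *
        (wDeriv (k - 1) ψ 1 * iteratedDeriv (m - k) (fun w => ℓ (fourier f w)) 1)) v := by
  set Q : ℝ := ‖ℓ‖ ^ 2 * (1 + 2 ^ (2 * m - 1) * (M + moment (2 * m) g))
  refine ⟨(Finset.Icc 1 m).card * ∑ k ∈ Finset.Icc 1 m, ((Finset.range (m - k + 1)).card : ℝ) *
    ∑ j ∈ Finset.range (m - k + 1), ((-1) ^ k * ((m - k).choose j : ℝ)) ^ 2 *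
      (coefA m j k g ψ 1 ^ 2 * Q), fun f hf hfm hM => ?_⟩
  have := isProbabilityMeasure_obsLaw hf G.pdf
  have hsum := MeanVar.sum (μ := obsLaw f g) (Finset.Icc 1 m) fun k _ =>
    MeanVar.sum (Finset.range (m - k + 1)) fun j hj =>
      ((G.meanVar_trigDeriv (ℓ := ℓ) hf hfm hM (j := j)
        ((Finset.mem_range_succ_iff.1 hj).trans (Nat.sub_le m k)) 1).const_mul
        (coefA m j k g ψ 1)).const_mul ((-1) ^ k * ((m - k).choose j : ℝ))
  refine ⟨hsum.memLp, hsum.mean.trans (Finset.sum_congr rfl fun k _ => ?_), hsum.variance_le⟩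
  rw [G.iteratedDeriv_clm_comp_fourier hf hfm (Nat.sub_le m k), Finset.mul_sum, Finset.mul_sum]
  refine Finset.sum_congr rfl fun j _ => ?_
  rw [coefA]
  ring

theorem ErrorModel.inv_mul_integral_trigDeriv_zero (G : ErrorModel m g K) (hf : IsPdf f)
    (hfm : HasMoment (2 * m) f) (ω : ℝ) :
    1 / (fourier g ω).re * ∫ y, trigDeriv ℓ 0 ω y ∂(obsLaw f g) = ℓ (fourier f ω) := by
  simpa [invDeriv] using (G.iteratedDeriv_clm_comp_fourier hf hfm (Nat.zero_le m) ω).symm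

theorem ErrorModel.const_nonneg (G : ErrorModel m g K) : 0 ≤ K :=
  let ⟨x, hx⟩ := G.bdd.exists
  (G.pdf.nonneg x).trans hx

/-- The integrand of the variance term of `rate`; up to a constant it bounds the square of
`tailWeight`. -/
noncomputable def noiseWeight (m : ℕ) (α β γ a b d ω : ℝ) : ℝ :=
  (ω ^ 2 + 1) ^ (α - ((m : ℝ) + 1) * a) * Real.exp (-2 * d * ω ^ b + 2 * γ * ω ^ β)

theorem noiseWeight_pos (m : ℕ) (α β γ a b d ω : ℝ) : 0 < noiseWeight m α β γ a b d ω := by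
  unfold noiseWeight
  positivity

theorem integral_noiseWeight_nonneg (m : ℕ) (α β γ a b d : ℝ) {T : ℝ} (hT : 1 ≤ T) :
    0 ≤ ∫ ω in (1 : ℝ)..T, noiseWeight m α β γ a b d ω :=
  intervalIntegral.integral_nonneg hT fun ω _ => (noiseWeight_pos m α β γ a b d ω).le

theorem continuous_noiseWeight (m : ℕ) (α γ a d : ℝ) (hb : 0 ≤ b) (hβ : 0 ≤ β) :
    Continuous (noiseWeight m α β γ a b d) := by
  have hpow : Continuous fun ω : ℝ => (ω ^ 2 + 1) ^ (α - ((m : ℝ) + 1) * a) :=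
    Continuous.rpow_const (by fun_prop) fun ω => .inl (by positivity)
  have : Continuous fun ω : ℝ => ω ^ b := Real.continuous_rpow_const hb
  have : Continuous fun ω : ℝ => ω ^ β := Real.continuous_rpow_const hβ
  unfold noiseWeight
  fun_prop

theorem noiseWeight_eq_sq_div_sq (m : ℕ) (α β γ a b d ω : ℝ) :
    noiseWeight m α β γ a b d ω =
      ((ω ^ 2 + 1) ^ (-(a * ((m : ℝ) + 1)) / 2) * Real.exp (-d * ω ^ b)) ^ 2 /
        ((ω ^ 2 + 1) ^ (-α / 2) * Real.exp (-γ * ω ^ β)) ^ 2 := by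
  have hx : 0 < ω ^ 2 + 1 := by positivity
  rw [noiseWeight, mul_pow, mul_pow, mul_div_mul_comm, ← Real.exp_nat_mul, ← Real.exp_nat_mul,
    ← Real.exp_sub, ← Real.rpow_mul_natCast hx.le, ← Real.rpow_mul_natCast hx.le,
    ← Real.rpow_sub hx]
  push_cast
  congr 2 <;> ring

theorem IsWeight.sq_tailWeight_le (hA1 : AssumptionA1 g α β γ C₁ C₂) (G : ErrorModel m g K)
    (hψ : IsWeight m a b d C ψ) {ω : ℝ} (hω : 1 ≤ ω) :
    tailWeight m g ψ ω ^ 2 ≤ (C / C₁) ^ 2 * noiseWeight m α β γ a b d ω := by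
  have hC₁ := hA1.C₁_pos
  have hlow := hA1.lower ω
  rw [← Complex.abs_re_eq_norm.2 (G.im_eq_zero ω), abs_of_nonneg (zero_le_one.trans hω)] at hlow
  have hnum := hψ.bound m le_rfl ω hω
  calc tailWeight m g ψ ω ^ 2 = |wDeriv m ψ ω| ^ 2 / |(fourier g ω).re| ^ 2 := by
        rw [tailWeight, mul_one_div, div_pow, sq_abs, sq_abs]
    _ ≤ (C * (ω ^ 2 + 1) ^ (-(a * ((m : ℝ) + 1)) / 2) * Real.exp (-d * ω ^ b)) ^ 2 /
        (C₁ * (ω ^ 2 + 1) ^ (-α / 2) * Real.exp (-γ * ω ^ β)) ^ 2 := by gcongr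
    _ = (C / C₁) ^ 2 * noiseWeight m α β γ a b d ω := by
        rw [noiseWeight_eq_sq_div_sq, mul_assoc C, mul_assoc C₁, mul_pow C, mul_pow C₁,
          mul_div_mul_comm, div_pow]

theorem ErrorModel.meanVar_tailObs (G : ErrorModel m g K) (hA1 : AssumptionA1 g α β γ C₁ C₂)
    (hf : IsPdf f) (hfm : HasMoment (2 * m) f) (hψ : IsWeight m a b d C ψ) (ha : 0 ≤ a)
    (hd : 0 ≤ d) (hb : 0 ≤ b) (hT : 1 ≤ T) :
    MeanVar (tailObs ℓ m g ψ T) (obsLaw f g)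
      ((-1) ^ m * ∫ ω in (1 : ℝ)..T, wDeriv m ψ ω * ℓ (fourier f ω))
      (‖ℓ‖ ^ 2 * (K * (2 * Real.pi)) * (C / C₁) ^ 2 *
        ∫ ω in (1 : ℝ)..T, noiseWeight m α β γ a b d ω) := by
  have := isProbabilityMeasure_obsLaw hf G.pdf
  have hκ := G.integrableOn_tailWeight hψ ha hd T
  have hnoise : IntegrableOn (fun ω => (C / C₁) ^ 2 * noiseWeight m α β γ a b d ω) (Icc 1 T) :=
    ((continuous_noiseWeight m α γ a d hb hA1.β_nonneg).continuousOn.integrableOn_Icc).const_mul _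
  have hsq : IntegrableOn (fun ω => tailWeight m g ψ ω ^ 2) (Icc 1 T) := by
    refine hnoise.mono' (hκ.1.pow 2) ?_
    filter_upwards [ae_restrict_mem measurableSet_Icc] with ω hω
    rw [Real.norm_of_nonneg (sq_nonneg _)]
    exact hψ.sq_tailWeight_le hA1 G hω.1
  have hK := G.const_nonneg
  have key := (meanVar_setIntegral_mul_trigDeriv_zero ℓ hK (obsLaw_le hf G.pdf G.bdd)
    measurableSet_Icc hκ ((memLp_two_iff_integrable_sq hκ.1).2 hsq)).const_mul ((-1) ^ m)
  refine ⟨key.memLp, key.mean.trans ?_, key.variance_le.trans ?_⟩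
  · rw [intervalIntegral.integral_of_le hT, ← integral_Icc_eq_integral_Ioc]
    simp_rw [tailWeight, mul_assoc (wDeriv m ψ _), G.inv_mul_integral_trigDeriv_zero hf hfm]
  · rw [← pow_mul, mul_comm m 2, pow_mul, neg_one_sq, one_pow, one_mul, mul_assoc _ ((C / C₁) ^ 2),
      intervalIntegral.integral_of_le hT, ← integral_Icc_eq_integral_Ioc,
      ← integral_const_mul ((C / C₁) ^ 2)]
    exact mul_le_mul_of_nonneg_left (setIntegral_mono_on hsq hnoise measurableSet_Icc
      fun ω hω => hψ.sq_tailWeight_le hA1 G hω.1) (by positivity)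

theorem ErrorModel.exists_meanVar_partObs (G : ErrorModel m g K)
    (hA1 : AssumptionA1 g α β γ C₁ C₂) (hψ : IsWeight m a b d C ψ) (ha : 0 ≤ a) (hd : 0 ≤ d)
    (hb : 0 ≤ b) (hℓ : ℓ ≠ 0) (Cσ M : ℝ) :
    ∃ v, ∀ f, PartAdmissible ℓ m g ψ Cσ f → moment (2 * m) f ≤ M → ∀ T, 1 ≤ T →
      MeanVar (partObs ℓ m g ψ T) (obsLaw f g) (cutoffIntegral m ψ (fun w => ℓ (fourier f w)) T)
        (v * (1 + ∫ ω in (1 : ℝ)..T, noiseWeight m α β γ a b d ω)) := by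
  obtain ⟨vB, hvB⟩ := G.exists_meanVar_boundaryObs ℓ ψ M
  set vU : ℝ := (m + 1) * ∑ j ∈ Finset.range (m + 1), (m.choose j : ℝ) ^ 2 * max Cσ 0
  set vT : ℝ := ‖ℓ‖ ^ 2 * (K * (2 * Real.pi)) * (C / C₁) ^ 2
  refine ⟨2 * (2 * (vU + vB) + vT), fun f hA hM T hT => ?_⟩
  have := isProbabilityMeasure_obsLaw hA.pdf G.pdf
  have hU := hA.meanVar_unitObs G hψ.measurable hℓ
  have hB := hvB f hA.pdf hA.hasMoment hM
  have hTail := G.meanVar_tailObs (ℓ := ℓ) hA1 hA.pdf hA.hasMoment hψ ha hd hb hT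
  refine ((hU.add hB).add hTail).mono ?_
  have hvU : 0 ≤ vU := hU.nonneg
  have hvB := hB.nonneg
  have hvT : 0 ≤ vT := by
    have := G.const_nonneg
    positivity
  have hUB := mul_nonneg (add_nonneg hvU hvB) (integral_noiseWeight_nonneg m α β γ a b d hT)
  linarith

end ObservationVariance

section TailBounds

variable {p b d H T x : ℝ}

theorem rpow_le_mul_exp (hp : 0 < p) (hd : 0 < d) (hx : 0 ≤ x) :
    x ^ p ≤ (p / d) ^ p * Real.exp (d * x) := by
  have hexp : d * x / p ≤ Real.exp (d * x / p) := by linarith [Real.add_one_le_exp (d * x / p)]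
  calc x ^ p = (p / d) ^ p * (d * x / p) ^ p := by
        rw [← Real.mul_rpow (by positivity) (by positivity)]
        field_simp
    _ ≤ (p / d) ^ p * Real.exp (d * x / p) ^ p := by gcongr
    _ = (p / d) ^ p * Real.exp (d * x) := by rw [← Real.exp_mul, div_mul_cancel₀ _ hp.ne']

theorem exists_rpow_le_mul_exp_sub_one (κ : ℝ) (hb : 0 < b) (hd : 0 < d) :
    ∃ C : ℝ, 0 < C ∧ ∀ t : ℝ, 1 ≤ t → t ^ κ ≤ C * Real.exp (d * (t ^ b - 1)) := by
  rcases le_or_gt κ 0 with hκ | hκ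
  · refine ⟨1, one_pos, fun t ht => (Real.rpow_le_one_of_one_le_of_nonpos ht hκ).trans ?_⟩
    rw [one_mul]
    exact Real.one_le_exp (mul_nonneg hd.le (sub_nonneg.2 (Real.one_le_rpow ht hb.le)))
  · refine ⟨(κ / b / d) ^ (κ / b) * Real.exp d, by positivity, fun t ht => ?_⟩
    have ht0 : 0 ≤ t := zero_le_one.trans ht
    calc t ^ κ = (t ^ b) ^ (κ / b) := by rw [← Real.rpow_mul ht0, mul_div_cancel₀ _ hb.ne']
      _ ≤ (κ / b / d) ^ (κ / b) * Real.exp (d * t ^ b) :=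
          rpow_le_mul_exp (by positivity) hd (by positivity)
      _ = (κ / b / d) ^ (κ / b) * Real.exp d * Real.exp (d * (t ^ b - 1)) := by
          rw [mul_assoc, ← Real.exp_add]
          ring_nf

theorem exists_rpow_mul_exp_le (κ : ℝ) (hb : 0 < b) (hd : 0 < d) :
    ∃ C : ℝ, 0 < C ∧ ∀ H ω : ℝ, 1 ≤ H → H ≤ ω →
      ω ^ κ * Real.exp (-d * ω ^ b) ≤ C * (H ^ κ * Real.exp (-d * H ^ b)) := by
  obtain ⟨C, hC, hCb⟩ := exists_rpow_le_mul_exp_sub_one κ hb hd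
  refine ⟨C, hC, fun H ω hH hω => ?_⟩
  have hH0 : 0 < H := one_pos.trans_le hH
  obtain ⟨t, ht, rfl⟩ : ∃ t, 1 ≤ t ∧ ω = H * t := ⟨ω / H, (one_le_div hH0).2 hω, by field_simp⟩
  have ht0 : 0 ≤ t := zero_le_one.trans ht
  have hHb : 1 ≤ H ^ b := Real.one_le_rpow hH hb.le
  have htb : 0 ≤ t ^ b - 1 := sub_nonneg.2 (Real.one_le_rpow ht hb.le)
  rw [Real.mul_rpow hH0.le ht0, Real.mul_rpow hH0.le ht0]
  calc H ^ κ * t ^ κ * Real.exp (-d * (H ^ b * t ^ b))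
      ≤ H ^ κ * (C * Real.exp (d * (t ^ b - 1))) * Real.exp (-d * (H ^ b * t ^ b)) := by
        gcongr
        exact hCb t ht
    _ ≤ H ^ κ * (C * Real.exp (d * (H ^ b * (t ^ b - 1)))) *
        Real.exp (-d * (H ^ b * t ^ b)) := by
        gcongr
        exact le_mul_of_one_le_left htb hHb
    _ = C * (H ^ κ * (Real.exp (d * (H ^ b * (t ^ b - 1))) *
        Real.exp (-d * (H ^ b * t ^ b)))) := by ring
    _ = C * (H ^ κ * Real.exp (-d * H ^ b)) := by
        rw [← Real.exp_add]
        ring_nf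

theorem continuousOn_rpow_mul_exp (p d : ℝ) (hb : 0 ≤ b) (hH : 0 < H) :
    ContinuousOn (fun ω : ℝ => ω ^ p * Real.exp (d * ω ^ b)) (Icc H T) := by
  have : Continuous fun ω : ℝ => ω ^ b := Real.continuous_rpow_const hb
  refine ContinuousOn.mul (fun ω hω => ?_) (by fun_prop)
  exact (Real.continuousAt_rpow_const ω p (.inl (hH.trans_le hω.1).ne')).continuousWithinAt

theorem intervalIntegrable_rpow_mul_exp (p d : ℝ) (hb : 0 ≤ b) (hH : 0 < H) (hT : H ≤ T) :
    IntervalIntegrable (fun ω : ℝ => ω ^ p * Real.exp (d * ω ^ b)) volume H T :=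
  (continuousOn_rpow_mul_exp p d hb hH).intervalIntegrable_of_Icc hT

theorem sq_rpow_mul_exp {ω : ℝ} (hω : 0 ≤ ω) (p d b : ℝ) :
    (ω ^ p * Real.exp (d * ω ^ b)) ^ 2 = ω ^ (2 * p) * Real.exp (2 * d * ω ^ b) := by
  rw [mul_pow, ← Real.rpow_mul_natCast hω, ← Real.exp_nat_mul]
  push_cast
  ring_nf

theorem integral_rpow_neg_le (hp : 1 < p) (hH : 0 < H) (hT : H ≤ T) :
    ∫ ω in H..T, ω ^ (-p) ≤ (p - 1)⁻¹ * H ^ (1 - p) := by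
  have h0 : (0 : ℝ) ∉ uIcc H T := by
    rw [uIcc_of_le hT]
    exact fun h => hH.not_ge h.1
  calc ∫ ω in H..T, ω ^ (-p) = (p - 1)⁻¹ * (H ^ (1 - p) - T ^ (1 - p)) := by
        rw [integral_rpow (.inr ⟨by linarith, h0⟩), neg_add_eq_sub, ← neg_sub p 1, div_neg,
          ← neg_div, neg_sub, div_eq_inv_mul]
    _ ≤ (p - 1)⁻¹ * H ^ (1 - p) :=
        mul_le_mul_of_nonneg_left (sub_le_self _ (Real.rpow_nonneg (hH.le.trans hT) _))
          (inv_nonneg.2 (sub_nonneg.2 hp.le))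

theorem integral_rpow_sub_one_mul_exp_le (hb : 0 < b) (hd : 0 < d) (hH : 0 < H) (hT : H ≤ T) :
    ∫ ω in H..T, ω ^ (b - 1) * Real.exp (-d * ω ^ b) ≤
      (d * b)⁻¹ * Real.exp (-d * H ^ b) := by
  have hderiv : ∀ x ∈ uIcc H T, HasDerivAt (fun ω : ℝ => -(d * b)⁻¹ * Real.exp (-d * ω ^ b))
      (x ^ (b - 1) * Real.exp (-d * x ^ b)) x := fun x hx => by
    rw [uIcc_of_le hT] at hx
    have hpow := Real.hasDerivAt_rpow_const (p := b) (.inl (hH.trans_le hx.1).ne')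
    refine (((hpow.const_mul (-d)).exp).const_mul (-(d * b)⁻¹)).congr_deriv ?_
    field_simp
  rw [intervalIntegral.integral_eq_sub_of_hasDerivAt hderiv
    (intervalIntegrable_rpow_mul_exp _ _ hb.le hH hT)]
  have : 0 < (d * b)⁻¹ * Real.exp (-d * T ^ b) := by positivity
  linarith

-- Half of the exponential makes `ω ^ (1 - p - b)` almost decreasing; the other half, multiplied by
-- the remaining factor `ω ^ (b - 1)`, has an explicit primitive.
theorem exists_integral_rpow_mul_exp_le_of_pos (p : ℝ) (hb : 0 < b) (hd : 0 < d) :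
    ∃ C : ℝ, 0 ≤ C ∧ ∀ H T : ℝ, 1 ≤ H → H ≤ T →
      ∫ ω in H..T, ω ^ (-p) * Real.exp (-d * ω ^ b) ≤
        C * (H ^ (1 - p - b) * Real.exp (-d * H ^ b)) := by
  obtain ⟨C, hC, hCb⟩ := exists_rpow_mul_exp_le (1 - p - b) hb (half_pos hd)
  refine ⟨C * (d / 2 * b)⁻¹, by positivity, fun H T hH hT => ?_⟩
  have hH0 : 0 < H := one_pos.trans_le hH
  have hexp : ∀ ω : ℝ, Real.exp (-d * ω ^ b) =
      Real.exp (-(d / 2) * ω ^ b) * Real.exp (-(d / 2) * ω ^ b) := fun ω => by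
    rw [← Real.exp_add]
    ring_nf
  set c := C * (H ^ (1 - p - b) * Real.exp (-(d / 2) * H ^ b))
  have hle : ∀ ω ∈ Icc H T, ω ^ (-p) * Real.exp (-d * ω ^ b) ≤
      c * (ω ^ (b - 1) * Real.exp (-(d / 2) * ω ^ b)) := fun ω hω => by
    have hω0 : 0 < ω := hH0.trans_le hω.1
    have hpow : ω ^ (-p) = ω ^ (1 - p - b) * ω ^ (b - 1) := by
      rw [← Real.rpow_add hω0]
      ring_nf
    calc ω ^ (-p) * Real.exp (-d * ω ^ b)
        = ω ^ (1 - p - b) * Real.exp (-(d / 2) * ω ^ b) *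
            (ω ^ (b - 1) * Real.exp (-(d / 2) * ω ^ b)) := by rw [hpow, hexp]; ring
      _ ≤ c * (ω ^ (b - 1) * Real.exp (-(d / 2) * ω ^ b)) := by
          gcongr
          exact hCb H ω hH hω.1
  calc ∫ ω in H..T, ω ^ (-p) * Real.exp (-d * ω ^ b)
      ≤ ∫ ω in H..T, c * (ω ^ (b - 1) * Real.exp (-(d / 2) * ω ^ b)) :=
        intervalIntegral.integral_mono_on hT (intervalIntegrable_rpow_mul_exp _ _ hb.le hH0 hT)
          ((intervalIntegrable_rpow_mul_exp _ _ hb.le hH0 hT).const_mul _) hle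
    _ ≤ c * ((d / 2 * b)⁻¹ * Real.exp (-(d / 2) * H ^ b)) := by
        rw [intervalIntegral.integral_const_mul]
        exact mul_le_mul_of_nonneg_left
          (integral_rpow_sub_one_mul_exp_le hb (half_pos hd) hH0 hT) (by positivity)
    _ = C * (d / 2 * b)⁻¹ * (H ^ (1 - p - b) * Real.exp (-d * H ^ b)) := by
        rw [hexp]
        ring

theorem exists_integral_rpow_mul_exp_le (hb : 0 ≤ b) (hbd : 0 < b → 0 < d)
    (h : 0 < b ∨ 1 < p + b) : ∃ C : ℝ, 0 ≤ C ∧ ∀ H T : ℝ, 1 ≤ H → H ≤ T →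
      ∫ ω in H..T, ω ^ (-p) * Real.exp (-d * ω ^ b) ≤
        C * (H ^ (1 - p - b) * Real.exp (-d * H ^ b)) := by
  rcases hb.eq_or_lt with rfl | hb
  · have hp : 1 < p := by simpa using h
    refine ⟨(p - 1)⁻¹, inv_nonneg.2 (sub_nonneg.2 hp.le), fun H T hH hT => ?_⟩
    simp only [Real.rpow_zero, mul_one, sub_zero]
    rw [intervalIntegral.integral_mul_const, ← mul_assoc]
    exact mul_le_mul_of_nonneg_right (integral_rpow_neg_le hp (one_pos.trans_le hH) hT)
      (Real.exp_pos _).le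
  · exact exists_integral_rpow_mul_exp_le_of_pos p hb (hbd hb)

theorem integral_mul_le_sqrt_mul_sqrt {φ χ : ℝ → ℝ} (hT : H ≤ T) (hφ : ContinuousOn φ (Icc H T))
    (hχ : ContinuousOn χ (Icc H T)) (hφ0 : ∀ ω ∈ Icc H T, 0 ≤ φ ω)
    (hχ0 : ∀ ω ∈ Icc H T, 0 ≤ χ ω) :
    ∫ ω in H..T, φ ω * χ ω ≤ √(∫ ω in H..T, φ ω ^ 2) * √(∫ ω in H..T, χ ω ^ 2) := by
  simp only [intervalIntegral.integral_of_le hT, ← integral_Icc_eq_integral_Ioc]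
  have hmemLp : ∀ {φ : ℝ → ℝ}, ContinuousOn φ (Icc H T) →
      MemLp φ (ENNReal.ofReal 2) (volume.restrict (Icc H T)) := fun h => by
    rw [ENNReal.ofReal_ofNat]
    exact (memLp_two_iff_integrable_sq (h.aestronglyMeasurable measurableSet_Icc)).2
      (h.pow 2).integrableOn_Icc
  have key := integral_mul_le_Lp_mul_Lq_of_nonneg (μ := volume.restrict (Icc H T))
    Real.HolderConjugate.two_two ((ae_restrict_mem measurableSet_Icc).mono hφ0)
    ((ae_restrict_mem measurableSet_Icc).mono hχ0) (hmemLp hφ) (hmemLp hχ)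
  simpa only [Real.rpow_two, ← Real.sqrt_eq_rpow] using key

end TailBounds

section Bias

variable {m : ℕ} {f g ψ : ℝ → ℝ} {a b d C s A B Cσ : ℝ} {ℓ : ℂ →L[ℝ] ℝ}

/-- The mean `cutoffIntegral` of the estimator of one part of `Φ` with bandwidth `1 / H` differs
from that part by at most `D H^(-A) exp(-d H^b)`. -/
def BiasBound (ℓ : ℂ →L[ℝ] ℝ) (m : ℕ) (ψ f : ℝ → ℝ) (A b d D : ℝ) : Prop :=
  ∀ H : ℝ, 1 ≤ H → |cutoffIntegral m ψ (fun w => ℓ (fourier f w)) H -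
    ∫ ω in Ioi (0 : ℝ), ψ ω * iteratedDeriv m (fun w => ℓ (fourier f w)) ω| ≤
      D * (H ^ (-A) * Real.exp (-d * H ^ b))

theorem rpow_eq_sq_rpow {ω : ℝ} (hω : 0 ≤ ω) (q : ℝ) : ω ^ q = (ω ^ 2) ^ (q / 2) := by
  rw [← Real.rpow_natCast_mul hω, Nat.cast_ofNat, mul_div_cancel₀ q two_ne_zero]

theorem IsWeight.abs_wDeriv_le (hψ : IsWeight m a b d C ψ) (ha : 0 ≤ a) {ω : ℝ} (hω : 1 ≤ ω) :
    |wDeriv m ψ ω| ≤ C * (ω ^ (-(((m : ℝ) + 1) * a)) * Real.exp (-d * ω ^ b)) := by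
  have hω0 : 0 < ω := one_pos.trans_le hω
  have hpow : (ω ^ 2 + 1) ^ (-(a * ((m : ℝ) + 1)) / 2) ≤ ω ^ (-(((m : ℝ) + 1) * a)) := by
    have hexp : -(a * ((m : ℝ) + 1)) / 2 ≤ 0 := by
      have : 0 ≤ a * ((m : ℝ) + 1) := by positivity
      linarith
    rw [rpow_eq_sq_rpow hω0.le, mul_comm _ a]
    exact Real.rpow_le_rpow_of_nonpos (by positivity) (by linarith) hexp
  refine (hψ.bound m le_rfl ω hω).trans ?_
  have := hψ.const_nonneg
  rw [mul_assoc]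
  gcongr

theorem IsWeight.abs_integral_wDeriv_mul_le (hψ : IsWeight m a b d C ψ) (ha : 0 ≤ a)
    (hd : 0 ≤ d) (ℓ : ℂ →L[ℝ] ℝ) (hf : IsPdf f) {H T : ℝ} (hH : 1 ≤ H) (hT : H ≤ T) {χ : ℝ → ℝ}
    (hχ : IntervalIntegrable χ volume H T) (hle : ∀ ω ∈ Icc H T,
      ω ^ (-(((m : ℝ) + 1) * a)) * Real.exp (-d * ω ^ b) * ‖fourier f ω‖ ≤ χ ω) :
    |∫ ω in H..T, wDeriv m ψ ω * ℓ (fourier f ω)| ≤ C * ‖ℓ‖ * ∫ ω in H..T, χ ω := by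
  have hC := hψ.const_nonneg
  refine (intervalIntegral.abs_integral_le_integral_abs hT).trans ?_
  rw [← intervalIntegral.integral_const_mul]
  refine intervalIntegral.integral_mono_on hT (hψ.intervalIntegrable_mul ha hd le_rfl hH hT
    (continuous_clm_comp_fourier ℓ hf)).abs (hχ.const_mul _) fun ω hω => ?_
  have hω0 : 0 < ω := one_pos.trans_le (hH.trans hω.1)
  calc |wDeriv m ψ ω * ℓ (fourier f ω)| = |wDeriv m ψ ω| * ‖ℓ (fourier f ω)‖ := abs_mul _ _
    _ ≤ C * (ω ^ (-(((m : ℝ) + 1) * a)) * Real.exp (-d * ω ^ b)) * (‖ℓ‖ * ‖fourier f ω‖) := by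
        gcongr
        · exact hψ.abs_wDeriv_le ha (hH.trans hω.1)
        · exact ℓ.le_opNorm _
    _ = C * ‖ℓ‖ * (ω ^ (-(((m : ℝ) + 1) * a)) * Real.exp (-d * ω ^ b) * ‖fourier f ω‖) := by ring
    _ ≤ C * ‖ℓ‖ * χ ω := by
        gcongr
        exact hle ω hω

theorem norm_fourier_le_of_mem_decayBall (hf : f ∈ DecayBall s B) {ω : ℝ} (hω : 0 < ω) :
    ‖fourier f ω‖ ≤ B * ω ^ (-s) := by
  rw [Real.rpow_neg hω.le, ← div_eq_mul_inv, le_div_iff₀ (by positivity)]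
  refine le_trans ?_ (hf ω)
  rw [abs_of_pos hω]
  gcongr
  exact le_add_of_nonneg_right zero_le_one

theorem nonneg_of_mem_decayBall (hf : f ∈ DecayBall s B) : 0 ≤ B :=
  le_trans (by positivity) (hf 0)

theorem IsWeight.exists_biasBound_decayBall (hψ : IsWeight m a b d C ψ) (ha : 0 ≤ a)
    (hb : 0 ≤ b) (hd : 0 ≤ d) (hbd : 0 < b → 0 < d) (ℓ : ℂ →L[ℝ] ℝ) (g : ℝ → ℝ) (Cσ B : ℝ)
    (hA : A = ((m : ℝ) + 1) * a + s + b - 1) (hbA : 0 < b ∨ 0 < A) :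
    ∃ D : ℝ, ∀ f ∈ DecayBall s B, PartAdmissible ℓ m g ψ Cσ f → BiasBound ℓ m ψ f A b d D := by
  set p := ((m : ℝ) + 1) * a + s
  obtain ⟨C', -, hC'⟩ := exists_integral_rpow_mul_exp_le (p := p) hb hbd
    (hbA.imp_right fun h => by linarith)
  refine ⟨C * ‖ℓ‖ * (B * C'), fun f hf hadm H hH => hψ.abs_cutoffIntegral_sub_le ha hd
    (continuous_clm_comp_fourier ℓ hadm.pdf)
    (tendsto_cutoffIntegral_clm_comp_fourier hadm hψ ha hd) hH fun T hT => ?_⟩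
  have hH0 : 0 < H := one_pos.trans_le hH
  have hB : 0 ≤ B := nonneg_of_mem_decayBall hf
  have hC := hψ.const_nonneg
  have hle : ∀ ω ∈ Icc H T, ω ^ (-(((m : ℝ) + 1) * a)) * Real.exp (-d * ω ^ b) * ‖fourier f ω‖ ≤
      B * (ω ^ (-p) * Real.exp (-d * ω ^ b)) := fun ω hω => by
    have hω0 : 0 < ω := hH0.trans_le hω.1
    calc _ ≤ ω ^ (-(((m : ℝ) + 1) * a)) * Real.exp (-d * ω ^ b) * (B * ω ^ (-s)) := by
          gcongr
          exact norm_fourier_le_of_mem_decayBall hf hω0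
      _ = _ := by
          rw [neg_add, Real.rpow_add hω0]
          ring
  calc |∫ ω in H..T, wDeriv m ψ ω * ℓ (fourier f ω)|
      ≤ C * ‖ℓ‖ * (B * ∫ ω in H..T, ω ^ (-p) * Real.exp (-d * ω ^ b)) := by
        rw [← intervalIntegral.integral_const_mul]
        exact hψ.abs_integral_wDeriv_mul_le ha hd ℓ hadm.pdf hH hT
          ((intervalIntegrable_rpow_mul_exp _ _ hb hH0 hT).const_mul B) hle
    _ ≤ C * ‖ℓ‖ * (B * (C' * (H ^ (1 - p - b) * Real.exp (-d * H ^ b)))) := by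
        gcongr
        exact hC' H T hH hT
    _ = C * ‖ℓ‖ * (B * C') * (H ^ (-A) * Real.exp (-d * H ^ b)) := by
        rw [hA]
        ring_nf

theorem continuous_norm_fourier_mul_rpow (hf : IsPdf f) (s : ℝ) :
    Continuous fun ω => ‖fourier f ω‖ * (ω ^ 2 + 1) ^ (s / 2) := by
  have := isProbabilityMeasure_law hf
  rw [fourier_eq_charFun hf]
  exact continuous_charFun.norm.mul
    (Continuous.rpow_const (by fun_prop) fun ω => .inl (by positivity))

theorem integral_sq_le_of_mem_sobolevBall (hf : f ∈ SobolevBall s B) (hpdf : IsPdf f) {H T : ℝ}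
    (hT : H ≤ T) : ∫ ω in H..T, (‖fourier f ω‖ * (ω ^ 2 + 1) ^ (s / 2)) ^ 2 ≤ B ^ 2 := by
  have hint : IntegrableOn (fun ω => (‖fourier f ω‖ * (ω ^ 2 + 1) ^ (s / 2)) ^ 2) (Ioc H T) :=
    ((continuous_norm_fourier_mul_rpow hpdf s).pow 2).continuousOn.integrableOn_Icc.mono_set
      Ioc_subset_Icc_self
  rw [intervalIntegral.integral_of_le hT, ← ENNReal.ofReal_le_ofReal_iff (sq_nonneg B),
    ofReal_integral_eq_lintegral_ofReal hint (.of_forall fun ω => sq_nonneg _)]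
  refine ((setLIntegral_le_lintegral _ _).trans_eq (lintegral_congr fun ω => ?_)).trans hf
  rw [mul_pow, ← Real.rpow_mul_natCast (by positivity), Nat.cast_ofNat,
    div_mul_cancel₀ s two_ne_zero]

theorem sqrt_integral_sq_rpow_mul_exp_le {p c C H T : ℝ} (hH : 0 < H) (hT : H ≤ T)
    (hC : ∫ ω in H..T, ω ^ (-(2 * p)) * Real.exp (-(2 * d) * ω ^ b) ≤
      C * (H ^ (2 * c) * Real.exp (-(2 * d) * H ^ b))) :
    √(∫ ω in H..T, (ω ^ (-p) * Real.exp (-d * ω ^ b)) ^ 2) ≤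
      √C * (H ^ c * Real.exp (-d * H ^ b)) := by
  have hsq : ∀ ω : ℝ, 0 ≤ ω → ∀ q : ℝ, (ω ^ q * Real.exp (-d * ω ^ b)) ^ 2 =
      ω ^ (2 * q) * Real.exp (-(2 * d) * ω ^ b) := fun ω hω q => by
    rw [sq_rpow_mul_exp hω, neg_mul_eq_mul_neg]
  have hint : ∫ ω in H..T, (ω ^ (-p) * Real.exp (-d * ω ^ b)) ^ 2 =
      ∫ ω in H..T, ω ^ (-(2 * p)) * Real.exp (-(2 * d) * ω ^ b) := by
    refine intervalIntegral.integral_congr fun ω hω => ?_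
    rw [uIcc_of_le hT] at hω
    simp only [hsq ω (hH.le.trans hω.1), neg_mul_eq_mul_neg]
  rw [hint, ← Real.sqrt_sq (by positivity : 0 ≤ H ^ c * Real.exp (-d * H ^ b)),
    ← Real.sqrt_mul' _ (sq_nonneg _), hsq H hH.le]
  exact Real.sqrt_le_sqrt hC

theorem rpow_neg_le_rpow_mul_rpow (q : ℝ) (hs : 0 ≤ s) {ω : ℝ} (hω : 0 < ω) :
    ω ^ (-q) ≤ ω ^ (-(q + s)) * (ω ^ 2 + 1) ^ (s / 2) :=
  calc ω ^ (-q) = ω ^ (-(q + s)) * (ω ^ 2) ^ (s / 2) := by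
        rw [← rpow_eq_sq_rpow hω.le, ← Real.rpow_add hω, neg_add, neg_add_cancel_right]
    _ ≤ ω ^ (-(q + s)) * (ω ^ 2 + 1) ^ (s / 2) := by
        gcongr
        exact le_add_of_nonneg_right zero_le_one

theorem IsWeight.exists_biasBound_sobolevBall (hψ : IsWeight m a b d C ψ) (ha : 0 ≤ a)
    (hb : 0 ≤ b) (hd : 0 ≤ d) (hbd : 0 < b → 0 < d) (hs : 0 ≤ s) (ℓ : ℂ →L[ℝ] ℝ) (g : ℝ → ℝ)
    (Cσ B : ℝ) (hA : A = ((m : ℝ) + 1) * a + s + (b - 1) / 2) (hbA : 0 < b ∨ 0 < A) :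
    ∃ D : ℝ, ∀ f ∈ SobolevBall s B, PartAdmissible ℓ m g ψ Cσ f → BiasBound ℓ m ψ f A b d D := by
  set p := ((m : ℝ) + 1) * a + s
  obtain ⟨C', -, hC'⟩ := exists_integral_rpow_mul_exp_le (p := 2 * p) (d := 2 * d) hb
    (fun h => mul_pos two_pos (hbd h)) (hbA.imp_right fun h => by linarith)
  refine ⟨C * ‖ℓ‖ * (√C' * |B|), fun f hf hadm H hH => hψ.abs_cutoffIntegral_sub_le ha hd
    (continuous_clm_comp_fourier ℓ hadm.pdf)
    (tendsto_cutoffIntegral_clm_comp_fourier hadm hψ ha hd) hH fun T hT => ?_⟩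
  have hH0 : 0 < H := one_pos.trans_le hH
  have hC := hψ.const_nonneg
  set φ : ℝ → ℝ := fun ω => ω ^ (-p) * Real.exp (-d * ω ^ b)
  set χ : ℝ → ℝ := fun ω => ‖fourier f ω‖ * (ω ^ 2 + 1) ^ (s / 2)
  have hφ : ContinuousOn φ (Icc H T) := continuousOn_rpow_mul_exp _ _ hb hH0
  have hχ : ContinuousOn χ (Icc H T) :=
    (continuous_norm_fourier_mul_rpow hadm.pdf s).continuousOn
  have hle : ∀ ω ∈ Icc H T,
      ω ^ (-(((m : ℝ) + 1) * a)) * Real.exp (-d * ω ^ b) * ‖fourier f ω‖ ≤ φ ω * χ ω :=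
    fun ω hω => by
      have hpow := rpow_neg_le_rpow_mul_rpow (((m : ℝ) + 1) * a) hs (hH0.trans_le hω.1)
      calc _ ≤ ω ^ (-p) * (ω ^ 2 + 1) ^ (s / 2) * Real.exp (-d * ω ^ b) * ‖fourier f ω‖ := by
            gcongr
        _ = φ ω * χ ω := by ring
  have hφ2 : √(∫ ω in H..T, φ ω ^ 2) ≤ √C' * (H ^ (-A) * Real.exp (-d * H ^ b)) := by
    refine sqrt_integral_sq_rpow_mul_exp_le hH0 hT ((hC' H T hH hT).trans_eq ?_)
    rw [hA]
    ring_nf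
  calc |∫ ω in H..T, wDeriv m ψ ω * ℓ (fourier f ω)|
      ≤ C * ‖ℓ‖ * ∫ ω in H..T, φ ω * χ ω := hψ.abs_integral_wDeriv_mul_le ha hd ℓ hadm.pdf hH hT
        ((hφ.mul hχ).intervalIntegrable_of_Icc hT) hle
    _ ≤ C * ‖ℓ‖ * (√(∫ ω in H..T, φ ω ^ 2) * √(∫ ω in H..T, χ ω ^ 2)) := by
        gcongr
        exact integral_mul_le_sqrt_mul_sqrt hT hφ hχ (fun ω hω => by
          have := hH0.trans_le hω.1
          positivity) fun ω _ => by positivity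
    _ ≤ C * ‖ℓ‖ * (√C' * (H ^ (-A) * Real.exp (-d * H ^ b)) * |B|) := by
        gcongr
        rw [← Real.sqrt_sq_eq_abs]
        exact Real.sqrt_le_sqrt (integral_sq_le_of_mem_sobolevBall hf hadm.pdf hT)
    _ = C * ‖ℓ‖ * (√C' * |B|) * (H ^ (-A) * Real.exp (-d * H ^ b)) := by ring

theorem IsWeight.exists_biasBound_class (hψ : IsWeight m a b d C ψ) (ha : 0 ≤ a)
    (hb : 0 ≤ b) (hd : 0 ≤ d) (hbd : 0 < b → 0 < d) (hs : 0 ≤ s) (ℓ : ℂ →L[ℝ] ℝ) (g : ℝ → ℝ)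
    (Cσ : ℝ) {F : Set (ℝ → ℝ)}
    (hFA : (F = DecayBall s B ∧ A = ((m : ℝ) + 1) * a + s + b - 1) ∨
      (F = SobolevBall s B ∧ A = ((m : ℝ) + 1) * a + s + (b - 1) / 2)) (hbA : 0 < b ∨ 0 < A) :
    ∃ D : ℝ, ∀ f ∈ F, PartAdmissible ℓ m g ψ Cσ f → BiasBound ℓ m ψ f A b d D := by
  rcases hFA with ⟨rfl, hA⟩ | ⟨rfl, hA⟩
  · exact hψ.exists_biasBound_decayBall ha hb hd hbd ℓ g Cσ B hA hbA
  · exact hψ.exists_biasBound_sobolevBall ha hb hd hbd hs ℓ g Cσ B hA hbA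

-- If `b = 0` and `A ≤ 0`, the claimed bound does not decay, so convergence of the truncated
-- integrals suffices; the constant then depends on `f`.
theorem PartAdmissible.exists_biasBound_of_nonpos (hadm : PartAdmissible ℓ m g ψ Cσ f)
    (hψ : IsWeight m a 0 d C ψ) (ha : 0 ≤ a) (hd : 0 ≤ d) (hA : A ≤ 0) :
    ∃ D : ℝ, BiasBound ℓ m ψ f A 0 d D := by
  obtain ⟨R, hR⟩ := hψ.exists_abs_cutoffIntegral_sub_le ha hd
    (continuous_clm_comp_fourier ℓ hadm.pdf)
    (tendsto_cutoffIntegral_clm_comp_fourier hadm hψ ha hd)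
  refine ⟨R * Real.exp d, fun H hH => (hR H hH).trans ?_⟩
  have hR0 : 0 ≤ R := (abs_nonneg _).trans (hR H hH)
  calc R = R * Real.exp d * (1 * Real.exp (-d * H ^ (0 : ℝ))) := by
        rw [Real.rpow_zero, one_mul, mul_assoc, ← Real.exp_add, mul_one, add_neg_cancel,
          Real.exp_zero, mul_one]
    _ ≤ R * Real.exp d * (H ^ (-A) * Real.exp (-d * H ^ (0 : ℝ))) := by
        gcongr
        exact Real.one_le_rpow hH (neg_nonneg.2 hA)

end Bias

section Rate

variable {m : ℕ} {α β γ a b d A : ℝ}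

theorem rate_eq (m : ℕ) (α β γ a b d A : ℝ) (n : ℕ) (h : ℝ) :
    rate m α β γ a b d A n h = h ^ (2 * A) * Real.exp (-2 * d * h ^ (-b)) +
      (n : ℝ)⁻¹ * ∫ ω in (1 : ℝ)..(1 / h), noiseWeight m α β γ a b d ω := rfl

theorem exists_pos_le_rpow_mul_exp (p c b : ℝ) {h₀ h₁ : ℝ} (h₀_pos : 0 < h₀) :
    ∃ ε : ℝ, 0 < ε ∧ ∀ h ∈ Icc h₀ h₁, ε ≤ h ^ p * Real.exp (c * h ^ b) := by
  have hpow : ∀ q : ℝ, ContinuousOn (fun h : ℝ => h ^ q) (Icc h₀ h₁) := fun q h hh =>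
    (Real.continuousAt_rpow_const h q (.inl (h₀_pos.trans_le hh.1).ne')).continuousWithinAt
  refine isCompact_Icc.exists_forall_le' ((hpow p).mul ((hpow b).const_mul c).rexp) fun h hh => ?_
  exact mul_pos (Real.rpow_pos_of_pos (h₀_pos.trans_le hh.1) p) (Real.exp_pos _)

theorem exists_pos_le_integral_noiseWeight (m : ℕ) (α γ a d : ℝ) (hb : 0 ≤ b) (hβ : 0 ≤ β) :
    ∃ δ : ℝ, 0 < δ ∧ ∀ T : ℝ, 2 ≤ T → δ ≤ ∫ ω in (1 : ℝ)..T, noiseWeight m α β γ a b d ω := by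
  have hc := continuous_noiseWeight m α γ a d hb hβ
  have hpos := noiseWeight_pos m α β γ a b d
  exact ⟨∫ ω in (1 : ℝ)..2, noiseWeight m α β γ a b d ω,
    intervalIntegral.intervalIntegral_pos_of_pos (hc.intervalIntegrable 1 2) hpos one_lt_two,
    fun T hT => intervalIntegral.integral_mono_interval le_rfl one_le_two hT
      (.of_forall fun ω => (hpos ω).le) (hc.intervalIntegrable _ _)⟩

-- For `h ≤ 1 / 2` the noise term dominates `1 / n`, for `1 / 2 ≤ h ≤ 1` the bias term does.
theorem exists_inv_le_rate (m : ℕ) (α γ a d A : ℝ) (hb : 0 ≤ b) (hβ : 0 ≤ β) :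
    ∃ κ : ℝ, 0 < κ ∧ ∀ n : ℕ, 1 ≤ n → ∀ h : ℝ, 0 < h → h ≤ 1 →
      (n : ℝ)⁻¹ ≤ κ * rate m α β γ a b d A n h := by
  obtain ⟨ε, hε, hbias⟩ := exists_pos_le_rpow_mul_exp (2 * A) (-2 * d) (-b) (h₁ := 1)
    (one_half_pos (α := ℝ))
  obtain ⟨δ, hδ, hnoise⟩ := exists_pos_le_integral_noiseWeight m α γ a d hb hβ
  have hε' := inv_pos.2 hε
  have hδ' := inv_pos.2 hδ
  refine ⟨ε⁻¹ + δ⁻¹, by positivity, fun n hn h hh0 hh1 => ?_⟩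
  have hJ := integral_noiseWeight_nonneg m α β γ a b d ((one_le_div hh0).2 hh1)
  have : (0 : ℝ) < (n : ℝ)⁻¹ := by positivity
  rw [rate_eq]
  rcases le_total h (1 / 2) with hle | hle
  · calc (n : ℝ)⁻¹ = δ⁻¹ * (0 + (n : ℝ)⁻¹ * δ) := by field_simp; simp
      _ ≤ _ := by
        gcongr
        · linarith
        · positivity
        · exact hnoise (1 / h) ((le_div_iff₀ hh0).2 (by linarith))
  · calc (n : ℝ)⁻¹ ≤ 1 := inv_le_one_of_one_le₀ (by exact_mod_cast hn)
      _ = ε⁻¹ * (ε + 0) := by rw [add_zero, inv_mul_cancel₀ hε.ne']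
      _ ≤ _ := by
        gcongr
        · linarith
        · exact hbias h ⟨hle, hh1⟩
        · positivity

theorem rpow_mul_exp_le_rate (m : ℕ) (α β γ a b d A : ℝ) (n : ℕ) {h : ℝ} (hT : 1 ≤ 1 / h) :
    h ^ (2 * A) * Real.exp (-2 * d * h ^ (-b)) ≤ rate m α β γ a b d A n h :=
  le_add_of_nonneg_right
    (mul_nonneg (by positivity) (integral_noiseWeight_nonneg m α β γ a b d hT))

theorem inv_mul_integral_noiseWeight_le_rate (m : ℕ) (α β γ a b d A : ℝ) (n : ℕ) {h : ℝ}
    (hh0 : 0 < h) :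
    (n : ℝ)⁻¹ * ∫ ω in (1 : ℝ)..(1 / h), noiseWeight m α β γ a b d ω ≤ rate m α β γ a b d A n h :=
  le_add_of_nonneg_left (by positivity)

theorem exists_noise_le_rate (m : ℕ) (α γ a d A : ℝ) (hb : 0 ≤ b) (hβ : 0 ≤ β) (v : ℝ) :
    ∃ V : ℝ, 0 ≤ V ∧ ∀ n : ℕ, 1 ≤ n → ∀ h : ℝ, 0 < h → h ≤ 1 →
      (n : ℝ)⁻¹ * (v * (1 + ∫ ω in (1 : ℝ)..(1 / h), noiseWeight m α β γ a b d ω)) ≤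
        V * rate m α β γ a b d A n h := by
  obtain ⟨κ, hκ, hinv⟩ := exists_inv_le_rate m α γ a d A hb hβ
  refine ⟨|v| * (κ + 1), by positivity, fun n hn h hh0 hh1 => ?_⟩
  set J := ∫ ω in (1 : ℝ)..(1 / h), noiseWeight m α β γ a b d ω
  set R := rate m α β γ a b d A n h
  have hJ : 0 ≤ J := integral_noiseWeight_nonneg m α β γ a b d ((one_le_div hh0).2 hh1)
  calc (n : ℝ)⁻¹ * (v * (1 + J)) = v * ((n : ℝ)⁻¹ + (n : ℝ)⁻¹ * J) := by ring
    _ ≤ |v| * ((n : ℝ)⁻¹ + (n : ℝ)⁻¹ * J) := by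
      gcongr
      exact le_abs_self v
    _ ≤ |v| * (κ * R + R) := by
      gcongr
      · exact hinv n hn h hh0 hh1
      · exact inv_mul_integral_noiseWeight_le_rate m α β γ a b d A n hh0
    _ = |v| * (κ + 1) * R := by ring

end Rate

section Risk

variable {m : ℕ} {f g ψ₁ ψ₂ : ℝ → ℝ} {K α β γ a b d A s B Cψ Cσ C₁ C₂ D₁ D₂ h : ℝ}

theorem BiasBound.sq_le (h₁ : BiasBound Complex.reCLM m ψ₁ f A b d D₁)
    (h₂ : BiasBound Complex.imCLM m ψ₂ f A b d D₂) (hh0 : 0 < h) (hh1 : h ≤ 1) :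
    (cutoffIntegral m ψ₁ (fun w => Complex.reCLM (fourier f w)) (1 / h) +
        cutoffIntegral m ψ₂ (fun w => Complex.imCLM (fourier f w)) (1 / h) - Phi m ψ₁ ψ₂ f) ^ 2 ≤
      (D₁ + D₂) ^ 2 * (h ^ (2 * A) * Real.exp (-2 * d * h ^ (-b))) := by
  have hT : 1 ≤ 1 / h := (one_le_div hh0).2 hh1
  have hpow : ∀ q : ℝ, (1 / h) ^ q = h ^ (-q) := fun q => by
    rw [one_div, Real.inv_rpow hh0.le, Real.rpow_neg hh0.le]
  have hsum := (abs_add_le _ _).trans (add_le_add (h₁ _ hT) (h₂ _ hT))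
  rw [sub_add_sub_comm, ← add_mul, hpow, hpow, neg_neg] at hsum
  calc _ ≤ ((D₁ + D₂) * (h ^ A * Real.exp (-d * h ^ (-b)))) ^ 2 :=
        sq_le_sq' (abs_le.1 hsum).1 (abs_le.1 hsum).2
    _ = _ := by rw [mul_pow, sq_rpow_mul_exp hh0.le, mul_neg, ← neg_mul 2 d]

theorem ErrorModel.exists_meanVar_partObs_add (G : ErrorModel m g K)
    (hA1 : AssumptionA1 g α β γ C₁ C₂) (h₁ : IsWeight m a b d Cψ ψ₁) (h₂ : IsWeight m a b d Cψ ψ₂)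
    (ha : 0 ≤ a) (hb : 0 ≤ b) (hd : 0 ≤ d) (Cσ M : ℝ) :
    ∃ v, ∀ f, Admissible m g ψ₁ ψ₂ Cσ f → moment (2 * m) f ≤ M → ∀ T, 1 ≤ T →
      MeanVar (fun y => partObs Complex.reCLM m g ψ₁ T y + partObs Complex.imCLM m g ψ₂ T y)
        (obsLaw f g) (cutoffIntegral m ψ₁ (fun w => Complex.reCLM (fourier f w)) T +
          cutoffIntegral m ψ₂ (fun w => Complex.imCLM (fourier f w)) T)
        (v * (1 + ∫ ω in (1 : ℝ)..T, noiseWeight m α β γ a b d ω)) := by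
  obtain ⟨v₁, hv₁⟩ := G.exists_meanVar_partObs hA1 h₁ ha hd hb reCLM_ne_zero Cσ M
  obtain ⟨v₂, hv₂⟩ := G.exists_meanVar_partObs hA1 h₂ ha hd hb imCLM_ne_zero Cσ M
  refine ⟨2 * (v₁ + v₂), fun f hA hM T hT => ?_⟩
  have := isProbabilityMeasure_obsLaw hA.pdf G.pdf
  refine ((hv₁ f hA.re hM T hT).add (hv₂ f hA.im hM T hT)).mono (le_of_eq ?_)
  ring

theorem ErrorModel.exists_riskBound (G : ErrorModel m g K) (hA1 : AssumptionA1 g α β γ C₁ C₂)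
    (h₁ : IsWeight m a b d Cψ ψ₁) (h₂ : IsWeight m a b d Cψ ψ₂) (ha : 0 ≤ a) (hb : 0 ≤ b)
    (hd : 0 ≤ d) (Cσ A M D₁ D₂ : ℝ) :
    ∃ C : ℝ, 0 < C ∧ ∀ f, Admissible m g ψ₁ ψ₂ Cσ f → moment (2 * m) f ≤ M →
      BiasBound Complex.reCLM m ψ₁ f A b d D₁ → BiasBound Complex.imCLM m ψ₂ f A b d D₂ →
        RiskBound.{u} m g ψ₁ ψ₂ f (fun n h => C * rate m α β γ a b d A n h) := by
  obtain ⟨v, hv⟩ := G.exists_meanVar_partObs_add hA1 h₁ h₂ ha hb hd Cσ M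
  obtain ⟨V, hV, hnoise⟩ := exists_noise_le_rate m α γ a d A hb hA1.β_nonneg v
  refine ⟨V + (D₁ + D₂) ^ 2 + 1, by positivity,
    fun f hA hM hbias₁ hbias₂ n hn h hh0 hh1 => ?_⟩
  have hT : 1 ≤ 1 / h := (one_le_div hh0).2 hh1
  refine ⟨fun y => ⟨fun j hj => ?_, ?_⟩, fun Ω _ P _ Y hY => ?_⟩
  · rw [intervalIntegrable_iff_integrableOn_Icc_of_le zero_le_one]
    exact G.integrableOn_integrand1 hA h₁.measurable h₂.measurable y hj
  · rw [intervalIntegrable_iff_integrableOn_Icc_of_le hT]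
    exact G.integrableOn_integrand2 h₁ h₂ ha hd y _
  simp_rw [G.PhiHat_eq hA h₁ h₂ ha hd hT]
  refine (hY.lintegral_sq_mean_sub_le hn ((G.measurable_partObs h₁ ha hd _).add
    (G.measurable_partObs h₂ ha hd _)) (hv f hA hM _ hT) _).trans (ENNReal.ofReal_le_ofReal ?_)
  have hrate := rpow_mul_exp_le_rate m α β γ a b d A n hT
  have hrate0 : 0 ≤ rate m α β γ a b d A n h := le_trans (by positivity) hrate
  have hvar := hnoise n hn h hh0 hh1
  have hbias : _ ≤ (D₁ + D₂) ^ 2 * rate m α β γ a b d A n h :=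
    (hbias₁.sq_le hbias₂ hh0 hh1).trans (mul_le_mul_of_nonneg_left hrate (sq_nonneg _))
  linarith

theorem IsWeight.exists_biasBound {ψ : ℝ → ℝ} {ℓ : ℂ →L[ℝ] ℝ} (hψ : IsWeight m a b d Cψ ψ)
    (ha : 0 ≤ a) (hb : 0 ≤ b) (hd : 0 ≤ d) (hbd : 0 < b → 0 < d) (hs : 0 ≤ s)
    {F : Set (ℝ → ℝ)} (hFA : (F = DecayBall s B ∧ A = ((m : ℝ) + 1) * a + s + b - 1) ∨
      (F = SobolevBall s B ∧ A = ((m : ℝ) + 1) * a + s + (b - 1) / 2))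
    (hf : f ∈ F) (hadm : PartAdmissible ℓ m g ψ Cσ f) : ∃ D, BiasBound ℓ m ψ f A b d D := by
  by_cases hbA : 0 < b ∨ 0 < A
  · obtain ⟨D, hD⟩ := hψ.exists_biasBound_class ha hb hd hbd hs ℓ g Cσ hFA hbA
    exact ⟨D, hD f hf hadm⟩
  · push Not at hbA
    obtain rfl : b = 0 := le_antisymm hbA.1 hb
    exact hadm.exists_biasBound_of_nonpos hψ ha hd hbA.2

theorem AssumptionA1.fourier_ne_zero (hA1 : AssumptionA1 g α β γ C₁ C₂) (ω : ℝ) :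
    fourier g ω ≠ 0 := by
  have := hA1.C₁_pos
  exact norm_pos_iff.1 (lt_of_lt_of_le (by positivity) (hA1.lower ω))

end Risk

end InvDeconv

theorem theorem4_general (m : ℕ) (g ψ₁ ψ₂ : ℝ → ℝ) (α β γ Cg₁ Cg₂ a b d Cψ Cσ s B : ℝ)
    (hg : IsPdf g) (hg_bdd : ∃ K : ℝ, ∀ᵐ x ∂volume, g x ≤ K) (hg_mom : HasMoment (2 * m) g)
    (hg_real : ∀ ω : ℝ, (fourier g ω).im = 0) (hA1 : AssumptionA1 g α β γ Cg₁ Cg₂)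
    (ha : 0 ≤ a) (hb : 0 ≤ b) (hd : 0 ≤ d) (hbd : d = 0 → b = 0)
    (hψ₁ : IsWeight m a b d Cψ ψ₁) (hψ₂ : IsWeight m a b d Cψ ψ₂)
    (hs : 0 ≤ s) (F : Set (ℝ → ℝ)) (A : ℝ)
    (hFA : (F = DecayBall s B ∧ A = ((m : ℝ) + 1) * a + s + b - 1) ∨
      (F = SobolevBall s B ∧ A = ((m : ℝ) + 1) * a + s + (b - 1) / 2)) :
    (∀ f ∈ F, Admissible m g ψ₁ ψ₂ Cσ f → ∃ C : ℝ, 0 < C ∧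
      RiskBound.{u} m g ψ₁ ψ₂ f (fun n h => C * rate m α β γ a b d A n h)) ∧
    (0 < b ∨ 0 < A → ∀ M : ℝ, ∃ C : ℝ, 0 < C ∧
      ∀ f ∈ F, Admissible m g ψ₁ ψ₂ Cσ f → moment (2 * m) f ≤ M →
        RiskBound.{u} m g ψ₁ ψ₂ f (fun n h => C * rate m α β γ a b d A n h)) := by
  obtain ⟨K, hK⟩ := hg_bdd
  have G : ErrorModel m g K := ⟨hg, hK, hg_mom, hg_real, fun ω hre =>
    hA1.fourier_ne_zero ω (Complex.ext hre (hg_real ω))⟩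
  have hbd' : 0 < b → 0 < d := fun hb0 => hd.lt_of_ne' fun hd0 => hb0.ne' (hbd hd0)
  refine ⟨fun f hf hadm => ?_, fun hbA M => ?_⟩
  · obtain ⟨D₁, hD₁⟩ := hψ₁.exists_biasBound ha hb hd hbd' hs hFA hf hadm.re
    obtain ⟨D₂, hD₂⟩ := hψ₂.exists_biasBound ha hb hd hbd' hs hFA hf hadm.im
    obtain ⟨C, hC, hrisk⟩ := G.exists_riskBound hA1 hψ₁ hψ₂ ha hb hd Cσ A (moment (2 * m) f) D₁ D₂
    exact ⟨C, hC, hrisk f hadm le_rfl hD₁ hD₂⟩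
  · obtain ⟨D₁, hD₁⟩ := hψ₁.exists_biasBound_class ha hb hd hbd' hs Complex.reCLM g Cσ hFA hbA
    obtain ⟨D₂, hD₂⟩ := hψ₂.exists_biasBound_class ha hb hd hbd' hs Complex.imCLM g Cσ hFA hbA
    obtain ⟨C, hC, hrisk⟩ := G.exists_riskBound hA1 hψ₁ hψ₂ ha hb hd Cσ A M D₁ D₂
    exact ⟨C, hC, fun f hf hadm hM =>
      hrisk f hadm hM (hD₁ f hf hadm.re) (hD₂ f hf hadm.im)⟩

theorem theorem4 (m : ℕ) (g ψ₁ ψ₂ : ℝ → ℝ)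
    (α β γ Cg₁ Cg₂ Cg τ a b d Cψ Cσ s B : ℝ)
    -- the error density
    (hg : IsPdf g) (hg_bdd : ∃ K : ℝ, ∀ᵐ x ∂volume, g x ≤ K)
    (hg_mom : HasMoment (2 * m) g)
    (hg_real : ∀ ω : ℝ, (fourier g ω).im = 0)
    (hA1 : AssumptionA1 g α β γ Cg₁ Cg₂)
    (hτ : 0 ≤ τ) (hτγ : γ = 0 → τ = 0)
    (hg_deriv : ∀ j ≤ m, ∀ ω : ℝ,
      ‖1 / fourier g ω * iteratedDeriv j (fourier g) ω‖ ≤ Cg * (|ω| + 1) ^ ((j : ℝ) * τ))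
    -- the weights
    (ha : 0 ≤ a) (hb : 0 ≤ b) (hd : 0 ≤ d) (hbd : d = 0 → b = 0)
    (hψ₁ : IsWeight m a b d Cψ ψ₁) (hψ₂ : IsWeight m a b d Cψ ψ₂)
    -- the class of mixing densities and the exponent
    (hs : 0 ≤ s) (F : Set (ℝ → ℝ)) (A : ℝ)
    (hFA : (F = DecayBall s B ∧ A = ((m : ℝ) + 1) * a + s + b - 1) ∨
      (F = SobolevBall s B ∧ A = ((m : ℝ) + 1) * a + s + (b - 1) / 2)) :
    (∀ f ∈ F, Admissible m g ψ₁ ψ₂ Cσ f → ∃ C : ℝ, 0 < C ∧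
      RiskBound.{u} m g ψ₁ ψ₂ f (fun n h => C * rate m α β γ a b d A n h)) ∧
    (0 < b ∨ 0 < A → ∀ M : ℝ, ∃ C : ℝ, 0 < C ∧
      ∀ f ∈ F, Admissible m g ψ₁ ψ₂ Cσ f → moment (2 * m) f ≤ M →
        RiskBound.{u} m g ψ₁ ψ₂ f (fun n h => C * rate m α β γ a b d A n h)) :=
  theorem4_general m g ψ₁ ψ₂ α β γ Cg₁ Cg₂ a b d Cψ Cσ s B hg hg_bdd hg_mom hg_real hA1 ha hb hd
    hbd hψ₁ hψ₂ hs F A hFA
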